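/- Fix a countably infinite set of propositional letters. Classical multimodal formulas and intuitionistic modal formulas are built from letters and $\bot$ with $\wedge,\vee,\to$ and the listed unary operators; $\neg\varphi:=\varphi\to\bot$. **Logics.** For an operator $\Box$, the $\mathsf{S4}$-axioms are $\Box(p\to q)\to(\Box p\to\Box q)$, $\Box p\to p$, $\Box p\to\Box\Box p$, and the $\mathsf{S5}$-axioms add $p\to\Box\neg\Box\neg p$. * $\mathsf{TS4}$ (operators $\Box,\blacksquare_F,\blacksquare_P$; $\Diamond=\neg\Box\neg$, $\blacklozenge_F=\neg\blacksquare_F\neg$, $\blacklozenge_P=\neg\blacksquare_P\neg$) is the least set of formulas that contains all classical tautologies, the $\mathsf{S4}$-axioms for each of $\Box,\blacksquare_F,\blacksquare_P$, and $p\to\blacksquare_P\blacklozenge_Fp$, $p\to\blacksquare_F\blacklozenge_Pp$, $\Diamond p\to\blacklozenge_Fp$, $\blacklozenge_Fp\to\Diamond(\blacklozenge_Fp\wedge\blacklozenge_Pp)$, and is closed under modus ponens, substitution and necessitation for the three operators. * $\mathsf{MS4}$ (operators $\Box,\forall$) is the least set of formulas that contains all classical tautologies, the $\mathsf{S4}$-axioms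 for $\Box$, the $\mathsf{S5}$-axioms for $\forall$, and $\Box\forall p\to\forall\Box p$, and is closed under modus ponens, substitution and necessitation for both operators. * $\mathsf{MIPC}$ (operators $\forall,\exists$) is the least set of formulas that contains all theorems of intuitionistic propositional logic and $\forall(p\wedge q)\leftrightarrow(\forall p\wedge\forall q)$, $\forall p\to p$, $\forall p\to\forall\forall p$, $\exists(p\vee q)\leftrightarrow(\exists p\vee\exists q)$, $p\to\exists p$, $\exists\exists p\to\exists p$, $(\exists p\wedge\exists q)\to\exists(\exists p\wedge q)$, $\exists\forall p\leftrightarrow\forall p$, $\exists p\leftrightarrow\forall\exists p$, and is closed under modus ponens, substitution, necessitation $\varphi/\forall\varphi$, and regularity $(\varphi\to\psi)/(\forall\varphi\to\forall\psi)$ and $(\varphi\to\psi)/(\exists\varphi\to\exists\psi)$. **Algebras.** An interior operator on a Heyting algebra preserves finite meets (including $1$) and satisfies $\mathsf{i}a\le a$, $\mathsf{i}a\le\mathsf{i}\mathsf{i}a$; a closure operator preserves finite joins (including $0$) and satisfies $a\le\mathsf{c}a$, $\mathsf{c}\mathsf{c}a\le\mathsf{c}a$. A $\mathsf{TS4}$-algebra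 is a Boolean algebra with interior operators $\Box,\blacksquare_F,\blacksquare_P$ satisfying $a\le\blacksquare_P\blacklozenge_Fa$, $a\le\blacksquare_F\blacklozenge_Pa$, $\Diamond a\le\blacklozenge_Fa$ and $\blacklozenge_Fa\le\Diamond(\blacklozenge_Fa\wedge\blacklozenge_Pa)$. An $\mathsf{MS4}$-algebra is a Boolean algebra with interior operators $\Box,\forall$ satisfying $a\le\forall\neg\forall\neg a$ and $\Box\forall a\le\forall\Box a$. An $\mathsf{MIPC}$-algebra (monadic Heyting algebra) is a Heyting algebra with an interior operator $\forall$ and a closure operator $\exists$ satisfying $\exists(\exists a\wedge b)=\exists a\wedge\exists b$, $\forall\exists a=\exists a$, $\exists\forall a=\forall a$. A formula is valid in an algebra if it takes the value $1$ under every assignment. **Frames.** For a quasi-order $Q$ write $xE_Qy$ iff $xQy$ and $yQx$. A $\mathsf{TS4}$-frame is a set with quasi-orders $R\subseteq Q$ such that $xQy$ implies $xRz$ and $zE_Qy$ for some $z$; $\Box,\blacksquare_F,\blacksquare_P$ are interpreted as the boxes of $R$, $Q$ and the converse of $Q$. An $\mathsf{MS4}$-frame is a set with a quasi-order $R$ and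 an equivalence relation $E$ such that $xEy$ and $yRz$ imply $xRu$ and $uEz$ for some $u$; $\Box,\forall$ are the boxes of $R,E$. An $\mathsf{MIPC}$-frame is a $\mathsf{TS4}$-frame in which $R$ is a partial order; letters are valued in $R$-upsets, the connectives are interpreted as in intuitionistic Kripke frames for $R$, $\forall\varphi$ holds at $x$ iff $\varphi$ holds at all $y$ with $xQy$, and $\exists\varphi$ holds at $x$ iff $\varphi$ holds at some $y$ with $xE_Qy$. A formula is valid in a frame if it holds at every point under every valuation. **Theorem.** Each of the logics $L=\mathsf{TS4}$, $L=\mathsf{MS4}$, $L=\mathsf{MIPC}$ has the finite model property: for every formula $\varphi$ in the language of $L$, $\varphi$ is not a theorem of $L$ if and only if $\varphi$ fails to be valid in some finite $L$-algebra, and also if and only if $\varphi$ fails to be valid in some finite $L$-frame. -/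

import Mathlib

namespace MonadicLogic

/-- Propositional formulas over countably many letters, with a unary modal operator
`op i` for every `i : I`. -/
inductive Formula (I : Type) : Type where
  | letter : ℕ → Formula I
  | bot : Formula I
  | and : Formula I → Formula I → Formula I
  | or : Formula I → Formula I → Formula I
  | imp : Formula I → Formula I → Formula I
  | op : I → Formula I → Formula I

namespace Formula

variable {I : Type}

/-- Negation `φ → ⊥`. -/
def neg (φ : Formula I) : Formula I := imp φ bot

/-- The biconditional. -/
def iff (φ ψ : Formula I) : Formula I := and (imp φ ψ) (imp ψ φ)

/-- The dual operator `¬ op i ¬`. -/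
def dual (i : I) (φ : Formula I) : Formula I := neg (op i (neg φ))

/-- Uniform substitution of formulas for letters. -/
def subst (s : ℕ → Formula I) : Formula I → Formula I
  | letter n => s n
  | bot => bot
  | and φ ψ => and (subst s φ) (subst s ψ)
  | or φ ψ => or (subst s φ) (subst s ψ)
  | imp φ ψ => imp (subst s φ) (subst s ψ)
  | op i φ => op i (subst s φ)

/-- The value of a formula in a Heyting algebra with operators (in particular in a Boolean
algebra, where `a ⇨ b = b ⊔ aᶜ`). -/
def eval {H : Type*} [HeytingAlgebra H] (f : I → H → H) (v : ℕ → H) : Formula I → H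
  | letter n => v n
  | bot => ⊥
  | and φ ψ => eval f v φ ⊓ eval f v ψ
  | or φ ψ => eval f v φ ⊔ eval f v ψ
  | imp φ ψ => eval f v φ ⇨ eval f v ψ
  | op i φ => f i (eval f v φ)

/-- Classical Kripke satisfaction: `op i` is the box of the relation `rel i`. -/
def Sat {X : Type*} (rel : I → X → X → Prop) (v : ℕ → Set X) : Formula I → X → Prop
  | letter n, x => x ∈ v n
  | bot, _ => False
  | and φ ψ, x => Sat rel v φ x ∧ Sat rel v ψ x
  | or φ ψ, x => Sat rel v φ x ∨ Sat rel v ψ x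
  | imp φ ψ, x => Sat rel v φ x → Sat rel v ψ x
  | op i φ, x => ∀ y, rel i x y → Sat rel v φ y

end Formula

open Formula

/-! ### Proof systems -/

/-- Hilbert axioms of the intuitionistic propositional calculus. -/
inductive IPCAxiom {I : Type} : Formula I → Prop
  | k (φ ψ : Formula I) : IPCAxiom (imp φ (imp ψ φ))
  | s (φ ψ χ : Formula I) :
      IPCAxiom (imp (imp φ (imp ψ χ)) (imp (imp φ ψ) (imp φ χ)))
  | and_left (φ ψ : Formula I) : IPCAxiom (imp (and φ ψ) φ)
  | and_right (φ ψ : Formula I) : IPCAxiom (imp (and φ ψ) ψ)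
  | and_intro (φ ψ : Formula I) : IPCAxiom (imp φ (imp ψ (and φ ψ)))
  | or_left (φ ψ : Formula I) : IPCAxiom (imp φ (or φ ψ))
  | or_right (φ ψ : Formula I) : IPCAxiom (imp ψ (or φ ψ))
  | or_elim (φ ψ χ : Formula I) :
      IPCAxiom (imp (imp φ χ) (imp (imp ψ χ) (imp (or φ ψ) χ)))
  | exfalso (φ : Formula I) : IPCAxiom (imp bot φ)

/-- Provability in the least classical multimodal logic that contains the formulas in `Ax`
and is closed under modus ponens, substitution and necessitation for all operators. -/
inductive ClassicalProvable {I : Type} (Ax : Formula I → Prop) : Formula I → Prop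
  | ipc {φ : Formula I} : IPCAxiom φ → ClassicalProvable Ax φ
  | dne (φ : Formula I) : ClassicalProvable Ax (imp (neg (neg φ)) φ)
  | ax {φ : Formula I} : Ax φ → ClassicalProvable Ax φ
  | mp {φ ψ : Formula I} :
      ClassicalProvable Ax (imp φ ψ) → ClassicalProvable Ax φ → ClassicalProvable Ax ψ
  | subst (s : ℕ → Formula I) {φ : Formula I} :
      ClassicalProvable Ax φ → ClassicalProvable Ax (φ.subst s)
  | nec (i : I) {φ : Formula I} :
      ClassicalProvable Ax φ → ClassicalProvable Ax (op i φ)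

/-- The `S4`-axioms for the operator `i`. -/
inductive S4Axiom {I : Type} (i : I) : Formula I → Prop
  | k (φ ψ : Formula I) : S4Axiom i (imp (op i (imp φ ψ)) (imp (op i φ) (op i ψ)))
  | t (φ : Formula I) : S4Axiom i (imp (op i φ) φ)
  | four (φ : Formula I) : S4Axiom i (imp (op i φ) (op i (op i φ)))

/-- The `S5`-axioms for the operator `i`. -/
inductive S5Axiom {I : Type} (i : I) : Formula I → Prop
  | s4 {φ : Formula I} : S4Axiom i φ → S5Axiom i φ
  | b (φ : Formula I) : S5Axiom i (imp φ (op i (dual i φ)))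

/-- The operators `□`, `∀` of `MS4`. -/
inductive MS4Op : Type where
  | box
  | all

/-- The modal axioms of `MS4`. -/
inductive MS4Axiom : Formula MS4Op → Prop
  | box {φ : Formula MS4Op} : S4Axiom .box φ → MS4Axiom φ
  | all {φ : Formula MS4Op} : S5Axiom .all φ → MS4Axiom φ
  | comm (φ : Formula MS4Op) :
      MS4Axiom (imp (op .box (op .all φ)) (op .all (op .box φ)))

/-- `MS4 ⊢ φ`. -/
def MS4Provable (φ : Formula MS4Op) : Prop := ClassicalProvable MS4Axiom φ

/-- The operators `□`, `■_F`, `■_P` of `TS4`. -/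
inductive TS4Op : Type where
  | box
  | boxF
  | boxP

/-- The modal axioms of `TS4`. -/
inductive TS4Axiom : Formula TS4Op → Prop
  | box {φ : Formula TS4Op} : S4Axiom .box φ → TS4Axiom φ
  | boxF {φ : Formula TS4Op} : S4Axiom .boxF φ → TS4Axiom φ
  | boxP {φ : Formula TS4Op} : S4Axiom .boxP φ → TS4Axiom φ
  | pf (φ : Formula TS4Op) : TS4Axiom (imp φ (op .boxP (dual .boxF φ)))
  | fp (φ : Formula TS4Op) : TS4Axiom (imp φ (op .boxF (dual .boxP φ)))
  | t1 (φ : Formula TS4Op) : TS4Axiom (imp (dual .box φ) (dual .boxF φ))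
  | t2 (φ : Formula TS4Op) :
      TS4Axiom (imp (dual .boxF φ) (dual .box (and (dual .boxF φ) (dual .boxP φ))))

/-- `TS4 ⊢ φ`. -/
def TS4Provable (φ : Formula TS4Op) : Prop := ClassicalProvable TS4Axiom φ

/-- The operators `∀`, `∃` of `MIPC`. -/
inductive MIPCOp : Type where
  | all
  | ex

/-- The modal axioms of `MIPC`. -/
inductive MIPCAxiom : Formula MIPCOp → Prop
  | all_and (φ ψ : Formula MIPCOp) :
      MIPCAxiom (iff (op .all (and φ ψ)) (and (op .all φ) (op .all ψ)))
  | all_le (φ : Formula MIPCOp) : MIPCAxiom (imp (op .all φ) φ)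
  | all_all (φ : Formula MIPCOp) : MIPCAxiom (imp (op .all φ) (op .all (op .all φ)))
  | ex_or (φ ψ : Formula MIPCOp) :
      MIPCAxiom (iff (op .ex (or φ ψ)) (or (op .ex φ) (op .ex ψ)))
  | le_ex (φ : Formula MIPCOp) : MIPCAxiom (imp φ (op .ex φ))
  | ex_ex (φ : Formula MIPCOp) : MIPCAxiom (imp (op .ex (op .ex φ)) (op .ex φ))
  | ex_and (φ ψ : Formula MIPCOp) :
      MIPCAxiom (imp (and (op .ex φ) (op .ex ψ)) (op .ex (and (op .ex φ) ψ)))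
  | ex_all (φ : Formula MIPCOp) : MIPCAxiom (iff (op .ex (op .all φ)) (op .all φ))
  | all_ex (φ : Formula MIPCOp) : MIPCAxiom (iff (op .ex φ) (op .all (op .ex φ)))

/-- `MIPC ⊢ φ`. The rule `reg` (from `φ → ψ` infer `∀φ → ∀ψ` and `∃φ → ∃ψ`) is part of
the notion of an intuitionistic modal logic. -/
inductive MIPCProvable : Formula MIPCOp → Prop
  | ipc {φ : Formula MIPCOp} : IPCAxiom φ → MIPCProvable φ
  | ax {φ : Formula MIPCOp} : MIPCAxiom φ → MIPCProvable φ
  | mp {φ ψ : Formula MIPCOp} :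
      MIPCProvable (imp φ ψ) → MIPCProvable φ → MIPCProvable ψ
  | subst (s : ℕ → Formula MIPCOp) {φ : Formula MIPCOp} :
      MIPCProvable φ → MIPCProvable (φ.subst s)
  | nec {φ : Formula MIPCOp} : MIPCProvable φ → MIPCProvable (op .all φ)
  | reg (i : MIPCOp) {φ ψ : Formula MIPCOp} :
      MIPCProvable (imp φ ψ) → MIPCProvable (imp (op i φ) (op i ψ))

/-! ### Algebras -/

/-- Interior operators on a Heyting algebra. A Boolean algebra with an interior operator is
an `S4`-algebra. -/
structure IsInterior {H : Type*} [HeytingAlgebra H] (i : H → H) : Prop where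
  map_inf : ∀ a b, i (a ⊓ b) = i a ⊓ i b
  map_top : i ⊤ = ⊤
  le_self : ∀ a, i a ≤ a
  le_idem : ∀ a, i a ≤ i (i a)

/-- Closure operators on a Heyting algebra. -/
structure IsClosure {H : Type*} [HeytingAlgebra H] (c : H → H) : Prop where
  map_sup : ∀ a b, c (a ⊔ b) = c a ⊔ c b
  map_bot : c ⊥ = ⊥
  self_le : ∀ a, a ≤ c a
  idem_le : ∀ a, c (c a) ≤ c a

/-- `MS4`-algebras (on a given Boolean algebra). -/
structure MS4Algebra (B : Type*) [BooleanAlgebra B] where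
  box : B → B
  all : B → B
  box_s4 : IsInterior box
  all_s4 : IsInterior all
  all_s5 : ∀ a, a ≤ all (all aᶜ)ᶜ
  comm : ∀ a, box (all a) ≤ all (box a)

/-- `TS4`-algebras (on a given Boolean algebra). -/
structure TS4Algebra (B : Type*) [BooleanAlgebra B] where
  box : B → B
  boxF : B → B
  boxP : B → B
  box_s4 : IsInterior box
  boxF_s4 : IsInterior boxF
  boxP_s4 : IsInterior boxP
  pf : ∀ a, a ≤ boxP (boxF aᶜ)ᶜ
  fp : ∀ a, a ≤ boxF (boxP aᶜ)ᶜ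
  t1 : ∀ a, (box aᶜ)ᶜ ≤ (boxF aᶜ)ᶜ
  t2 : ∀ a, (boxF aᶜ)ᶜ ≤ (box ((boxF aᶜ)ᶜ ⊓ (boxP aᶜ)ᶜ)ᶜ)ᶜ

/-- Monadic Heyting algebras (on a given Heyting algebra). -/
structure MonadicHeytingAlgebra (H : Type*) [HeytingAlgebra H] where
  all : H → H
  ex : H → H
  all_interior : IsInterior all
  ex_closure : IsClosure ex
  ex_inf : ∀ a b, ex (ex a ⊓ b) = ex a ⊓ ex b
  all_ex : ∀ a, all (ex a) = ex a
  ex_all : ∀ a, ex (all a) = all a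

/-- The interpretation of the operators of `MS4`. -/
def MS4Algebra.ops {B : Type*} [BooleanAlgebra B] (A : MS4Algebra B) : MS4Op → B → B
  | .box => A.box
  | .all => A.all

/-- The interpretation of the operators of `TS4`. -/
def TS4Algebra.ops {B : Type*} [BooleanAlgebra B] (A : TS4Algebra B) : TS4Op → B → B
  | .box => A.box
  | .boxF => A.boxF
  | .boxP => A.boxP

/-- The interpretation of the operators of `MIPC`. -/
def MonadicHeytingAlgebra.ops {H : Type*} [HeytingAlgebra H]
    (A : MonadicHeytingAlgebra H) : MIPCOp → H → H
  | .all => A.all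
  | .ex => A.ex

/-- `φ` is valid in the `MS4`-algebra `A`. -/
def MS4Algebra.Valid {B : Type*} [BooleanAlgebra B] (A : MS4Algebra B)
    (φ : Formula MS4Op) : Prop :=
  ∀ v : ℕ → B, φ.eval A.ops v = ⊤

/-- `φ` is valid in the `TS4`-algebra `A`. -/
def TS4Algebra.Valid {B : Type*} [BooleanAlgebra B] (A : TS4Algebra B)
    (φ : Formula TS4Op) : Prop :=
  ∀ v : ℕ → B, φ.eval A.ops v = ⊤

/-- `φ` is valid in the monadic Heyting algebra `A`. -/
def MonadicHeytingAlgebra.Valid {H : Type*} [HeytingAlgebra H]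
    (A : MonadicHeytingAlgebra H) (φ : Formula MIPCOp) : Prop :=
  ∀ v : ℕ → H, φ.eval A.ops v = ⊤

/-! ### Frames -/

/-- `MS4`-frames on the set `X`. -/
structure MS4Frame (X : Type*) where
  R : X → X → Prop
  E : X → X → Prop
  R_refl : ∀ x, R x x
  R_trans : ∀ x y z, R x y → R y z → R x z
  E_equiv : Equivalence E
  comm : ∀ x y z, E x y → R y z → ∃ u, R x u ∧ E u z

/-- `TS4`-frames on the set `X`. -/
structure TS4Frame (X : Type*) where
  R : X → X → Prop
  Q : X → X → Prop
  R_refl : ∀ x, R x x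
  R_trans : ∀ x y z, R x y → R y z → R x z
  Q_refl : ∀ x, Q x x
  Q_trans : ∀ x y z, Q x y → Q y z → Q x z
  R_sub_Q : ∀ x y, R x y → Q x y
  exists_of_Q : ∀ x y, Q x y → ∃ z, R x z ∧ (Q z y ∧ Q y z)

/-- `MIPC`-frames on the set `X`: `TS4`-frames in which `R` is a partial order. -/
structure MIPCFrame (X : Type*) extends TS4Frame X where
  R_antisymm : ∀ x y, R x y → R y x → x = y

/-- The accessibility relations of the operators of `MS4`. -/
def MS4Frame.rel {X : Type*} (F : MS4Frame X) : MS4Op → X → X → Prop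
  | .box => F.R
  | .all => F.E

/-- The accessibility relations of the operators of `TS4`; that of `■_P` is the converse
of `Q`. -/
def TS4Frame.rel {X : Type*} (F : TS4Frame X) : TS4Op → X → X → Prop
  | .box => F.R
  | .boxF => F.Q
  | .boxP => fun x y => F.Q y x

/-- Satisfaction in `MIPC`-frames. -/
def MIPCFrame.Sat {X : Type*} (F : MIPCFrame X) (v : ℕ → Set X) :
    Formula MIPCOp → X → Prop
  | .letter n, x => x ∈ v n
  | .bot, _ => False
  | .and φ ψ, x => F.Sat v φ x ∧ F.Sat v ψ x
  | .or φ ψ, x => F.Sat v φ x ∨ F.Sat v ψ x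
  | .imp φ ψ, x => ∀ y, F.R x y → F.Sat v φ y → F.Sat v ψ y
  | .op .all φ, x => ∀ y, F.Q x y → F.Sat v φ y
  | .op .ex φ, x => ∃ y, (F.Q x y ∧ F.Q y x) ∧ F.Sat v φ y

/-- `φ` is valid in the `MS4`-frame `F`. -/
def MS4Frame.Valid {X : Type*} (F : MS4Frame X) (φ : Formula MS4Op) : Prop :=
  ∀ (v : ℕ → Set X) (x : X), φ.Sat F.rel v x

/-- `φ` is valid in the `TS4`-frame `F`. -/
def TS4Frame.Valid {X : Type*} (F : TS4Frame X) (φ : Formula TS4Op) : Prop :=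
  ∀ (v : ℕ → Set X) (x : X), φ.Sat F.rel v x

/-- `φ` is valid in the `MIPC`-frame `F`; letters are valued in `R`-upsets. -/
def MIPCFrame.Valid {X : Type*} (F : MIPCFrame X) (φ : Formula MIPCOp) : Prop :=
  ∀ v : ℕ → Set X, (∀ n x y, x ∈ v n → F.R x y → y ∈ v n) → ∀ x : X, F.Sat v φ x

/-! ### The finite model property

A formula is unprovable if and only if it is refuted in a finite algebra for the logic, if and
only if it is refuted in a finite frame for the logic. -/

/-- `TS4` has the finite model property. -/
def TS4HasFMP : Prop :=
  ∀ φ : Formula TS4Op,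
    (¬ TS4Provable φ ↔
      ∃ (B : Type) (_ : BooleanAlgebra B) (_ : Finite B) (A : TS4Algebra B), ¬ A.Valid φ) ∧
    (¬ TS4Provable φ ↔ ∃ (X : Type) (_ : Finite X) (F : TS4Frame X), ¬ F.Valid φ)

/-- `MS4` has the finite model property. -/
def MS4HasFMP : Prop :=
  ∀ φ : Formula MS4Op,
    (¬ MS4Provable φ ↔
      ∃ (B : Type) (_ : BooleanAlgebra B) (_ : Finite B) (A : MS4Algebra B), ¬ A.Valid φ) ∧
    (¬ MS4Provable φ ↔ ∃ (X : Type) (_ : Finite X) (F : MS4Frame X), ¬ F.Valid φ)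

/-- `MIPC` has the finite model property. -/
def MIPCHasFMP : Prop :=
  ∀ φ : Formula MIPCOp,
    (¬ MIPCProvable φ ↔
      ∃ (H : Type) (_ : HeytingAlgebra H) (_ : Finite H) (A : MonadicHeytingAlgebra H),
        ¬ A.Valid φ) ∧
    (¬ MIPCProvable φ ↔ ∃ (X : Type) (_ : Finite X) (F : MIPCFrame X), ¬ F.Valid φ)

end MonadicLogic

/-! Soundness is checked in algebras; frames inherit it through their complex algebras. For
completeness, an unprovable formula is refuted in the Lindenbaum algebra, and the refutation is then
moved to a finite frame, whose complex algebra is the required finite algebra.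

Let `S` be the finite set of values of subformulas. In each logic some operator `e` sends an element
to the least fixed point above it of a second operator: `∃` in MIPC, `¬∀¬` in MS4, `¬■_P¬` (with
fixed points of `■_F`) in TS4. On a suitable sublattice it satisfies `e (e a ⊓ b) = e a ⊓ e b`, so
finitely many elements generate a finite sublattice closed under `e` (`exists_finite_sublattice`).
Neither implication nor complement is among the generating operations, which is why finiteness
survives.

The worlds are the traces of prime filters on a finite set containing `S` and this sublattice. `R`
is inclusion on a sublattice `D` of the finite one (all of it in MIPC, its `□`-fixed elements in the
classical cases). `Q` is inclusion, and `E` agreement, on a sublattice `G` of fixed points of `∀` or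
`■_F`. The mixed frame condition asks for a filter extending the `D`-part of one filter and having
the same `G`-part as another; `Point.exists_amalgam` builds it from the implication `u ⊓ b ≤ c → e u
⊓ b ≤ c` for `u ∈ D` and `b, c ∈ G`. Since `D` and `G` contain the relevant modal values, the prime
filter theorem also yields the truth lemma. -/

namespace MonadicLogic

/-! ### Points of a bounded distributive lattice -/

/-- Points of a bounded lattice: its homomorphisms to `Prop`, that is, its prime filters. -/
abbrev Point (L : Type*) [Lattice L] [BoundedOrder L] := BoundedLatticeHom L Prop

namespace Point

section Lattice

variable {L : Type*} [Lattice L] [BoundedOrder L] (x : Point L)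

lemma inf_iff (a b : L) : x (a ⊓ b) ↔ x a ∧ x b := by simp

lemma sup_iff (a b : L) : x (a ⊔ b) ↔ x a ∨ x b := by simp

lemma top : x ⊤ := by simp

lemma not_bot : ¬ x ⊥ := by simp

lemma mono {a b : L} (h : a ≤ b) (ha : x a) : x b := OrderHomClass.mono x h ha

end Lattice

lemma compl_iff {B : Type*} [BooleanAlgebra B] (x : Point B) (a : B) : x aᶜ ↔ ¬ x a := by
  have h1 := x.inf_iff a aᶜ
  have h2 := x.sup_iff a aᶜ
  rw [inf_compl_self] at h1
  rw [sup_compl_eq_top] at h2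
  have := x.top
  have := x.not_bot
  tauto

lemma himp_iff {B : Type*} [BooleanAlgebra B] (x : Point B) (a b : B) :
    x (a ⇨ b) ↔ (x a → x b) := by
  rw [himp_eq, sup_iff, compl_iff]; tauto

variable {L : Type*} [DistribLattice L] [BoundedOrder L]

/-- Prime filter theorem for a base of a filter and a base of an ideal. -/
lemma exists_of_forall_not_le {P N : Set L} (hP : InfClosed P) (hP0 : P.Nonempty)
    (hN : SupClosed N) (hN0 : N.Nonempty) (h : ∀ p ∈ P, ∀ n ∈ N, ¬ p ≤ n) :
    ∃ x : Point L, (∀ p ∈ P, x p) ∧ ∀ n ∈ N, ¬ x n := by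
  have hF : Order.IsPFilter {a : L | ∃ p ∈ P, p ≤ a} := by
    refine Order.IsPFilter.of_def ?_ ?_ ?_
    · obtain ⟨p, hp⟩ := hP0
      exact ⟨p, p, hp, le_rfl⟩
    · rintro a ⟨p, hp, hpa⟩ b ⟨q, hq, hqb⟩
      exact ⟨p ⊓ q, ⟨p ⊓ q, hP hp hq, le_rfl⟩, inf_le_left.trans hpa, inf_le_right.trans hqb⟩
    · rintro a b hab ⟨p, hp, hpa⟩
      exact ⟨p, hp, hpa.trans hab⟩
  have hI : Order.IsIdeal {a : L | ∃ n ∈ N, a ≤ n} := by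
    refine ⟨?_, ?_, ?_⟩
    · rintro a b hab ⟨n, hn, han⟩
      exact ⟨n, hn, le_trans hab han⟩
    · obtain ⟨n, hn⟩ := hN0
      exact ⟨n, n, hn, le_rfl⟩
    · rintro a ⟨p, hp, hpa⟩ b ⟨q, hq, hqb⟩
      exact ⟨p ⊔ q, ⟨p ⊔ q, hN hp hq, le_rfl⟩, hpa.trans le_sup_left, hqb.trans le_sup_right⟩
  have hdisj : Disjoint (hF.toPFilter : Set L) (hI.toIdeal : Set L) := by
    rw [Set.disjoint_left]
    rintro a ⟨p, hp, hpa⟩ ⟨n, hn, han⟩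
    exact h p hp n hn (hpa.trans han)
  obtain ⟨J, hJ, hIJ, hFJ⟩ := DistribLattice.prime_ideal_of_disjoint_filter_ideal hdisj
  rw [Set.disjoint_left] at hFJ
  have hPJ : ∀ p ∈ P, p ∉ J := fun p hp => hFJ ⟨p, hp, le_rfl⟩
  have hNJ : ∀ n ∈ N, n ∈ J := fun n hn => hIJ ⟨n, hn, le_rfl⟩
  -- The point is the complement of the prime ideal.
  refine ⟨{ toFun := fun a => a ∉ J, map_sup' := ?_, map_inf' := ?_, map_top' := ?_,
            map_bot' := ?_ }, hPJ, fun n hn hn' => hn' (hNJ n hn)⟩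
  · intro a b
    have : a ⊔ b ∈ J ↔ a ∈ J ∧ b ∈ J := Order.Ideal.sup_mem_iff
    exact propext (by simp only [this]; simp; tauto)
  · intro a b
    have : a ⊓ b ∈ J ↔ a ∈ J ∨ b ∈ J :=
      ⟨hJ.mem_or_mem, fun h => h.elim (J.lower inf_le_left) (J.lower inf_le_right)⟩
    exact propext (by simp only [this]; simp)
  · obtain ⟨p, hp⟩ := hP0
    simpa using fun h => hPJ p hp (J.lower le_top h)
  · simp

/-- A version of the prime filter theorem for a single element to be avoided. -/
lemma exists_not_of_forall_not_le {P : Set L} (hP : InfClosed P) (hP0 : P.Nonempty) {a : L}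
    (h : ∀ p ∈ P, ¬ p ≤ a) : ∃ x : Point L, (∀ p ∈ P, x p) ∧ ¬ x a := by
  obtain ⟨x, h1, h2⟩ := exists_of_forall_not_le hP hP0 (supClosed_singleton (a := a))
    (Set.singleton_nonempty a) (by simpa using h)
  exact ⟨x, h1, h2 a rfl⟩

lemma exists_not_of_ne_top {a : L} (h : a ≠ ⊤) : ∃ x : Point L, ¬ x a := by
  obtain ⟨x, -, hx⟩ := exists_not_of_forall_not_le (P := ({⊤} : Set L)) infClosed_singleton
    (Set.singleton_nonempty _) (a := a) (by rintro p rfl; rwa [top_le_iff])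
  exact ⟨x, hx⟩

/-- Amalgamation of the `D`-part of a point `s` with the `G`-part of a point `t`. -/
lemma exists_amalgam {D G : Set L} (hD : InfClosed D) (hD0 : ⊤ ∈ D) (hG : IsSublattice G)
    (hG0 : ⊤ ∈ G) (hG1 : ⊥ ∈ G) {e : L → L}
    (he : ∀ u ∈ D, ∀ b ∈ G, ∀ c ∈ G, u ⊓ b ≤ c → e u ⊓ b ≤ c) (s t : Point L)
    (hst : ∀ u ∈ D, s u → t (e u)) :
    ∃ x : Point L, (∀ u ∈ D, s u → x u) ∧ ∀ b ∈ G, x b ↔ t b := by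
  -- `P` forces the `D`-part of `s` and the `G`-part of `t`; `N` keeps out the rest of `G`, so that
  -- `x` and `t` agree on `G`. If `u ⊓ b ≤ c`, then `e u ⊓ b ≤ c` would put `c` into `t`.
  obtain ⟨x, h1, h2⟩ := exists_of_forall_not_le
    (P := {p | ∃ u ∈ D, ∃ b ∈ G, s u ∧ t b ∧ p = u ⊓ b}) (N := {c | c ∈ G ∧ ¬ t c})
    (by
      rintro _ ⟨u, hu, b, hb, hsu, htb, rfl⟩ _ ⟨u', hu', b', hb', hsu', htb', rfl⟩
      exact ⟨u ⊓ u', hD hu hu', b ⊓ b', hG.2 hb hb', by simp [hsu, hsu'], by simp [htb, htb'],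
        inf_inf_inf_comm _ _ _ _⟩)
    ⟨_, ⊤, hD0, ⊤, hG0, s.top, t.top, rfl⟩
    (by
      rintro c ⟨hc, htc⟩ d ⟨hd, htd⟩
      exact ⟨hG.1 hc hd, by simp [htc, htd]⟩)
    ⟨⊥, hG1, t.not_bot⟩
    (by
      rintro _ ⟨u, hu, b, hb, hsu, htb, rfl⟩ c ⟨hc, htc⟩ hle
      exact htc (t.mono (he u hu b hb c hc hle) ((t.inf_iff _ _).2 ⟨hst u hu hsu, htb⟩)))
  refine ⟨x, fun u hu hsu => h1 _ ⟨u, hu, ⊤, hG0, hsu, t.top, (inf_top_eq u).symm⟩,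
    fun b hb => ⟨fun hxb => by_contra fun htb => h2 b ⟨hb, htb⟩ hxb, fun htb =>
      h1 _ ⟨⊤, hD0, b, hb, s.top, htb, (top_inf_eq b).symm⟩⟩⟩

end Point

/-! ### Traces of points on a set -/

/-- The restrictions of points to a subset `F`. -/
def Trace {L : Type*} [Lattice L] [BoundedOrder L] (F : Set L) : Type _ :=
  Set.range fun (x : Point L) (a : F) => x a

namespace Trace

variable {L : Type*} [Lattice L] [BoundedOrder L] {F : Set L}

lemma finite (hF : F.Finite) : Finite (Trace F) :=
  have := hF.to_subtype
  inferInstanceAs (Finite (Set.range fun (x : Point L) (a : F) => x a))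

/-- A point with the given trace. -/
noncomputable def rep (t : Trace F) : Point L := t.2.choose

/-- The trace of a point. -/
def mk (F : Set L) (x : Point L) : Trace F := ⟨_, x, rfl⟩

/-- `rep` is an arbitrary choice among points with the same trace, so it can be compared with `x`
only on `F`. -/
lemma rep_mk (x : Point L) {a : L} (ha : a ∈ F) : (mk F x).rep a ↔ x a :=
  iff_of_eq (congrFun (mk F x).2.choose_spec ⟨a, ha⟩)

lemma ext {s t : Trace F} (h : ∀ a ∈ F, s.rep a ↔ t.rep a) : s = t := by
  apply Subtype.ext
  rw [← s.2.choose_spec, ← t.2.choose_spec]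
  funext a
  exact propext (h a a.2)

end Trace

/-! ### Finite sublattices closed under a monadic operator -/

/-- On a bounded sublattice `U` whose elements satisfy `e (e a ⊓ b) = e a ⊓ e b`, every finite
set generates a finite bounded sublattice closed under `e`. -/
lemma exists_finite_sublattice {L : Type*} [DistribLattice L] [BoundedOrder L] {U : Set L}
    (hU : IsSublattice U) (hUt : ⊤ ∈ U) (hUb : ⊥ ∈ U) {e : L → L} (heU : ∀ a ∈ U, e a ∈ U)
    (hsup : ∀ a ∈ U, ∀ b ∈ U, e (a ⊔ b) = e a ⊔ e b) (hle : ∀ a ∈ U, a ≤ e a)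
    (hinf : ∀ a ∈ U, ∀ b ∈ U, e (e a ⊓ b) = e a ⊓ e b) {T : Set L} (hT : T.Finite)
    (hTU : T ⊆ U) :
    ∃ D : Set L, D.Finite ∧ T ⊆ D ∧ D ⊆ U ∧ IsSublattice D ∧ ⊤ ∈ D ∧ ⊥ ∈ D ∧
      ∀ a ∈ D, e a ∈ D := by
  have htop : e ⊤ = ⊤ := top_le_iff.1 (hle ⊤ hUt)
  have hidem : ∀ a ∈ U, e (e a) = e a := fun a ha => by
    simpa [htop] using hinf a ha ⊤ hUt
  set G : Set L := infClosure (insert ⊥ (insert ⊤ T)) with hG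
  have hGU : G ⊆ U := infClosure_min
    (Set.insert_subset hUb (Set.insert_subset hUt hTU)) hU.2
  have hGb : ⊥ ∈ G := subset_infClosure (by simp)
  have hGt : ⊤ ∈ G := subset_infClosure (by simp)
  have hTG : T ⊆ G := fun t ht => subset_infClosure (by simp [ht])
  -- Meets of values of `e` are again fixed by `e`. For such `c`, `e (a ⊓ c) = e a ⊓ c`, so the
  -- meets `a ⊓ c` with `a ∈ G` form a finite set closed under `e`. As `e` preserves joins, closing
  -- under joins keeps this property.
  set E : Set L := infClosure (e '' G) with hE
  have heE : ∀ a ∈ G, e a ∈ E := fun a ha => subset_infClosure ⟨a, ha, rfl⟩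
  have hEU : E ⊆ {c | c ∈ U ∧ e c = c} := by
    refine infClosure_min ?_ ?_
    · rintro _ ⟨a, ha, rfl⟩
      exact ⟨heU a (hGU ha), hidem a (hGU ha)⟩
    · rintro c ⟨hc, hec⟩ d ⟨hd, hed⟩
      refine ⟨hU.2 hc hd, ?_⟩
      have := hinf c hc d hd
      rwa [hec, hed] at this
  set M : Set L := Set.image2 (· ⊓ ·) G E with hM
  have hMU : M ⊆ U := by
    rintro _ ⟨a, ha, c, hc, rfl⟩
    exact hU.2 (hGU ha) (hEU hc).1
  have hMinf : InfClosed M := by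
    rintro _ ⟨a, ha, c, hc, rfl⟩ _ ⟨b, hb, d, hd, rfl⟩
    exact ⟨a ⊓ b, infClosed_infClosure ha hb, c ⊓ d, infClosed_infClosure hc hd,
      inf_inf_inf_comm _ _ _ _⟩
  have hGM : G ⊆ M := fun a ha => ⟨a, ha, ⊤, htop ▸ heE ⊤ hGt, inf_top_eq a⟩
  have heM : ∀ m ∈ M, e m ∈ M := by
    rintro _ ⟨a, ha, c, hc, rfl⟩
    refine ⟨⊤, hGt, e a ⊓ c, infClosed_infClosure (heE a ha) hc, ?_⟩
    have := hinf c (hEU hc).1 a (hGU ha)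
    rw [(hEU hc).2] at this
    simp only [top_inf_eq]
    rw [inf_comm a c, this, inf_comm]
  have hMD : M ⊆ supClosure M := subset_supClosure
  have hGfin : G.Finite := ((hT.insert ⊤).insert ⊥).infClosure
  have hDU : supClosure M ⊆ U := supClosure_min hMU hU.1
  refine ⟨supClosure M, ((hGfin.image2 _ (hGfin.image e).infClosure)).supClosure,
    hTG.trans (hGM.trans hMD), hDU, ⟨supClosed_supClosure, hMinf.supClosure⟩,
    hMD (hGM hGt), hMD (hGM hGb), ?_⟩
  have : supClosure M ⊆ {a | a ∈ U ∧ e a ∈ supClosure M} := by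
    refine supClosure_min (fun m hm => ⟨hMU hm, hMD (heM m hm)⟩) ?_
    rintro a ⟨ha, ha'⟩ b ⟨hb, hb'⟩
    refine ⟨hU.1 ha hb, ?_⟩
    rw [hsup a ha b hb]
    exact supClosed_supClosure ha' hb'
  exact fun a ha => (this ha).2

/-! ### Values of subformulas -/

namespace Formula

variable {I : Type} {H : Type*} [HeytingAlgebra H] (f : I → H → H) (v : ℕ → H)

/-- The values of the subformulas of a formula. -/
def subvalues : Formula I → Set H
  | letter n => {v n}
  | bot => {⊥}
  | and φ ψ => insert (eval f v (and φ ψ)) (subvalues φ ∪ subvalues ψ)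
  | or φ ψ => insert (eval f v (or φ ψ)) (subvalues φ ∪ subvalues ψ)
  | imp φ ψ => insert (eval f v (imp φ ψ)) (subvalues φ ∪ subvalues ψ)
  | op i φ => insert (eval f v (op i φ)) (subvalues φ)

lemma finite_subvalues (φ : Formula I) : (subvalues f v φ).Finite := by
  induction φ with
  | letter n => exact Set.finite_singleton _
  | bot => exact Set.finite_singleton _
  | and φ ψ h1 h2 => exact (h1.union h2).insert _
  | or φ ψ h1 h2 => exact (h1.union h2).insert _
  | imp φ ψ h1 h2 => exact (h1.union h2).insert _
  | op i φ h => exact h.insert _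

lemma eval_mem_subvalues (φ : Formula I) : eval f v φ ∈ subvalues f v φ := by
  cases φ <;> simp [subvalues, eval]

/-- Truth lemma for the traces of points of a Boolean algebra with operators. -/
lemma sat_iff_rep_eval {B : Type*} [BooleanAlgebra B] (f : I → B → B) (v : ℕ → B) {S F : Set B}
    {rel : I → Trace F → Trace F → Prop}
    (hrel : ∀ i, ∀ a ∈ S, f i a ∈ S → ∀ t, t.rep (f i a) ↔ ∀ s, rel i t s → s.rep a)
    (φ : Formula I) (hφ : subvalues f v φ ⊆ S) (t : Trace F) :
    Sat rel (fun n => {s | s.rep (v n)}) φ t ↔ t.rep (eval f v φ) := by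
  -- `t.rep` is a homomorphism on the whole of `B`, so the Boolean cases need no closure properties
  -- of `F`; only the modal case depends on the trace.
  induction φ generalizing t with
  | letter n => rfl
  | bot => simp [Sat, eval]
  | and φ ψ h1 h2 =>
    obtain ⟨-, h⟩ := Set.insert_subset_iff.1 hφ
    obtain ⟨h3, h4⟩ := Set.union_subset_iff.1 h
    simp only [Sat, eval, Point.inf_iff, h1 h3, h2 h4]
  | or φ ψ h1 h2 =>
    obtain ⟨-, h⟩ := Set.insert_subset_iff.1 hφ
    obtain ⟨h3, h4⟩ := Set.union_subset_iff.1 h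
    simp only [Sat, eval, Point.sup_iff, h1 h3, h2 h4]
  | imp φ ψ h1 h2 =>
    obtain ⟨-, h⟩ := Set.insert_subset_iff.1 hφ
    obtain ⟨h3, h4⟩ := Set.union_subset_iff.1 h
    simp only [Sat, eval, Point.himp_iff, h1 h3, h2 h4]
  | op i φ h1 =>
    obtain ⟨h2, h⟩ := Set.insert_subset_iff.1 hφ
    simp only [Sat, eval, h1 h]
    exact (hrel i _ (h (eval_mem_subvalues f v φ)) h2 t).symm

end Formula

open Formula

/-! ### Lindenbaum algebras -/

/-- Sets of formulas that contain the intuitionistic calculus and are closed under modus ponens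
and congruence for the operators. -/
structure IsCongruential {I : Type} (Pr : Formula I → Prop) : Prop where
  ipc : ∀ {φ}, IPCAxiom φ → Pr φ
  mp : ∀ {φ ψ}, Pr (imp φ ψ) → Pr φ → Pr ψ
  congr : ∀ (i : I) {φ ψ}, Pr (imp φ ψ) → Pr (imp ψ φ) → Pr (imp (op i φ) (op i ψ))

namespace IsCongruential

variable {I : Type} {Pr : Formula I → Prop} (h : IsCongruential Pr) {φ ψ χ θ : Formula I}
include h

lemma weaken (h1 : Pr φ) : Pr (imp ψ φ) := h.mp (h.ipc (.k _ _)) h1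

lemma distrib (h1 : Pr (imp φ (imp ψ χ))) (h2 : Pr (imp φ ψ)) : Pr (imp φ χ) :=
  h.mp (h.mp (h.ipc (.s _ _ _)) h1) h2

lemma refl (φ : Formula I) : Pr (imp φ φ) :=
  h.distrib (h.ipc (.k φ (imp φ φ))) (h.ipc (.k φ φ))

lemma trans (h1 : Pr (imp φ ψ)) (h2 : Pr (imp ψ χ)) : Pr (imp φ χ) :=
  h.distrib (h.weaken h2) h1

lemma and_intro (h1 : Pr (imp φ ψ)) (h2 : Pr (imp φ χ)) : Pr (imp φ (and ψ χ)) :=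
  h.distrib (h.trans h1 (h.ipc (.and_intro _ _))) h2

lemma or_elim (h1 : Pr (imp φ χ)) (h2 : Pr (imp ψ χ)) : Pr (imp (or φ ψ) χ) :=
  h.mp (h.mp (h.ipc (.or_elim _ _ _)) h1) h2

lemma uncurry (h1 : Pr (imp φ (imp ψ χ))) : Pr (imp (and φ ψ) χ) :=
  h.distrib (h.trans (h.ipc (.and_left _ _)) h1) (h.ipc (.and_right _ _))

lemma curry (h1 : Pr (imp (and φ ψ) χ)) : Pr (imp φ (imp ψ χ)) :=
  h.trans (h.ipc (.and_intro φ ψ)) (h.mp (h.ipc (.s _ _ _)) (h.weaken h1))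

lemma and_mono (h1 : Pr (imp φ ψ)) (h2 : Pr (imp χ θ)) : Pr (imp (and φ χ) (and ψ θ)) :=
  h.and_intro (h.trans (h.ipc (.and_left _ _)) h1) (h.trans (h.ipc (.and_right _ _)) h2)

lemma or_mono (h1 : Pr (imp φ ψ)) (h2 : Pr (imp χ θ)) : Pr (imp (or φ χ) (or ψ θ)) :=
  h.or_elim (h.trans h1 (h.ipc (.or_left _ _))) (h.trans h2 (h.ipc (.or_right _ _)))

lemma imp_mono (h1 : Pr (imp ψ φ)) (h2 : Pr (imp χ θ)) : Pr (imp (imp φ χ) (imp ψ θ)) :=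
  h.curry (h.trans (h.trans (h.and_mono (h.refl _) h1) (h.uncurry (h.refl _))) h2)

/-- Provable equivalence. -/
def setoid : Setoid (Formula I) where
  r φ ψ := Pr (imp φ ψ) ∧ Pr (imp ψ φ)
  iseqv := ⟨fun φ => ⟨h.refl φ, h.refl φ⟩, fun h1 => ⟨h1.2, h1.1⟩,
    fun h1 h2 => ⟨h.trans h1.1 h2.1, h.trans h2.2 h1.2⟩⟩

end IsCongruential

/-- Formulas modulo provable equivalence. -/
def Lindenbaum {I : Type} {Pr : Formula I → Prop} (h : IsCongruential Pr) : Type :=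
  Quotient h.setoid

namespace Lindenbaum

variable {I : Type} {Pr : Formula I → Prop} {h : IsCongruential Pr}

/-- The class of a formula. -/
def mk (h : IsCongruential Pr) (φ : Formula I) : Lindenbaum h := Quotient.mk h.setoid φ

instance : HeytingAlgebra (Lindenbaum h) where
  le := Quotient.lift₂ (fun φ ψ => Pr (imp φ ψ)) fun _ _ _ _ h1 h2 => propext
    ⟨fun h3 => h.trans h1.2 (h.trans h3 h2.1), fun h3 => h.trans h1.1 (h.trans h3 h2.2)⟩
  le_refl := by rintro ⟨φ⟩; exact h.refl φ
  le_trans := by rintro ⟨φ⟩ ⟨ψ⟩ ⟨χ⟩ h1 h2; exact h.trans h1 h2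
  le_antisymm := by rintro ⟨φ⟩ ⟨ψ⟩ h1 h2; exact Quotient.sound ⟨h1, h2⟩
  sup := Quotient.map₂ Formula.or fun _ _ h1 _ _ h2 =>
    ⟨h.or_mono h1.1 h2.1, h.or_mono h1.2 h2.2⟩
  le_sup_left := by rintro ⟨φ⟩ ⟨ψ⟩; exact h.ipc (.or_left _ _)
  le_sup_right := by rintro ⟨φ⟩ ⟨ψ⟩; exact h.ipc (.or_right _ _)
  sup_le := by rintro ⟨φ⟩ ⟨ψ⟩ ⟨χ⟩ h1 h2; exact h.or_elim h1 h2
  inf := Quotient.map₂ Formula.and fun _ _ h1 _ _ h2 =>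
    ⟨h.and_mono h1.1 h2.1, h.and_mono h1.2 h2.2⟩
  inf_le_left := by rintro ⟨φ⟩ ⟨ψ⟩; exact h.ipc (.and_left _ _)
  inf_le_right := by rintro ⟨φ⟩ ⟨ψ⟩; exact h.ipc (.and_right _ _)
  le_inf := by rintro ⟨φ⟩ ⟨ψ⟩ ⟨χ⟩ h1 h2; exact h.and_intro h1 h2
  top := mk h (imp bot bot)
  le_top := by rintro ⟨φ⟩; exact h.weaken (h.refl bot)
  bot := mk h bot
  bot_le := by rintro ⟨φ⟩; exact h.ipc (.exfalso _)
  himp := Quotient.map₂ Formula.imp fun _ _ h1 _ _ h2 =>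
    ⟨h.imp_mono h1.2 h2.1, h.imp_mono h1.1 h2.2⟩
  le_himp_iff := by rintro ⟨φ⟩ ⟨ψ⟩ ⟨χ⟩; exact ⟨h.uncurry, h.curry⟩
  compl := Quotient.map Formula.neg fun _ _ h1 =>
    ⟨h.imp_mono h1.2 (h.refl bot), h.imp_mono h1.1 (h.refl bot)⟩
  himp_bot := by rintro ⟨φ⟩; rfl

/-- The operators of the Lindenbaum algebra. -/
def ops (h : IsCongruential Pr) (i : I) : Lindenbaum h → Lindenbaum h :=
  Quotient.map (op i) fun _ _ h1 => ⟨h.congr i h1.1 h1.2, h.congr i h1.2 h1.1⟩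

lemma mk_eq_top_iff {φ : Formula I} : mk h φ = ⊤ ↔ Pr φ := by
  rw [← top_le_iff]
  exact ⟨fun h1 : Pr (imp (imp bot bot) φ) => h.mp h1 (h.refl bot),
    fun h1 => (h.weaken h1 : Pr (imp (imp bot bot) φ))⟩

lemma eval_mk (φ : Formula I) : φ.eval (ops h) (fun n => mk h (letter n)) = mk h φ := by
  induction φ with
  | letter n => rfl
  | bot => rfl
  | and φ ψ h1 h2 => rw [eval, h1, h2]; rfl
  | or φ ψ h1 h2 => rw [eval, h1, h2]; rfl
  | imp φ ψ h1 h2 => rw [eval, h1, h2]; rfl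
  | op i φ h1 => rw [eval, h1]; rfl

end Lindenbaum

/-! ### Lindenbaum algebras of classical multimodal logics -/

section Classical

variable {I : Type} {Ax : Formula I → Prop} (hAx : ∀ i φ, S4Axiom i φ → ClassicalProvable Ax φ)
include hAx

lemma ClassicalProvable.mono_op (i : I) {φ ψ : Formula I} (h : ClassicalProvable Ax (imp φ ψ)) :
    ClassicalProvable Ax (imp (op i φ) (op i ψ)) :=
  .mp (hAx i _ (.k φ ψ)) (.nec i h)

lemma ClassicalProvable.isCongruential : IsCongruential (ClassicalProvable Ax) where
  ipc := .ipc
  mp := .mp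
  congr i _ _ h _ := h.mono_op hAx i

/-- The Lindenbaum algebra of a classical multimodal logic. -/
def ClassicalLindenbaum : Type := Lindenbaum (ClassicalProvable.isCongruential hAx)

instance : BooleanAlgebra (ClassicalLindenbaum hAx) :=
  letI : HeytingAlgebra (ClassicalLindenbaum hAx) :=
    inferInstanceAs (HeytingAlgebra (Lindenbaum _))
  -- A Heyting algebra is Boolean once every `a ⊔ aᶜ` is regular; double negation elimination makes
  -- every element regular.
  BooleanAlgebra.ofRegular fun a => le_antisymm
    (by
      generalize a ⊔ aᶜ = b
      obtain ⟨φ⟩ := b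
      exact ClassicalProvable.dne φ) le_compl_compl

/-- The operators of the Lindenbaum algebra of a classical multimodal logic. -/
def ClassicalLindenbaum.ops (i : I) : ClassicalLindenbaum hAx → ClassicalLindenbaum hAx :=
  Lindenbaum.ops (ClassicalProvable.isCongruential hAx) i

lemma ClassicalLindenbaum.isInterior_ops (i : I) : IsInterior (ops hAx i) where
  map_inf := by
    have h := ClassicalProvable.isCongruential hAx
    rintro ⟨φ⟩ ⟨ψ⟩
    refine Quotient.sound ⟨h.and_intro (.mono_op hAx i (.ipc (.and_left _ _)))
      (.mono_op hAx i (.ipc (.and_right _ _))), ?_⟩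
    exact h.uncurry (h.trans (.mono_op hAx i (.ipc (.and_intro φ ψ))) (hAx i _ (.k _ _)))
  map_top := Lindenbaum.mk_eq_top_iff.2 (.nec i (IsCongruential.refl (ClassicalProvable.isCongruential hAx) bot))
  le_self := by rintro ⟨φ⟩; exact hAx i _ (.t φ)
  le_idem := by rintro ⟨φ⟩; exact hAx i _ (.four φ)

lemma ClassicalProvable.exists_eval_ne_top {φ : Formula I} (h : ¬ ClassicalProvable Ax φ) :
    ∃ v : ℕ → ClassicalLindenbaum hAx,
      φ.eval (ClassicalLindenbaum.ops hAx) v ≠ ⊤ := by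
  refine ⟨fun n => Lindenbaum.mk _ (letter n), fun h1 => h ?_⟩
  exact Lindenbaum.mk_eq_top_iff.1 ((Lindenbaum.eval_mk φ).symm.trans h1)

end Classical

/-! ### Soundness -/

section Soundness

variable {I : Type} {H : Type*} [HeytingAlgebra H]

lemma Formula.eval_subst (f : I → H → H) (v : ℕ → H) (s : ℕ → Formula I) (φ : Formula I) :
    (φ.subst s).eval f v = φ.eval f fun n => (s n).eval f v := by
  induction φ with
  | letter n => rfl
  | bot => rfl
  | and φ ψ h1 h2 => simp only [Formula.subst, eval, h1, h2]
  | or φ ψ h1 h2 => simp only [Formula.subst, eval, h1, h2]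
  | imp φ ψ h1 h2 => simp only [Formula.subst, eval, h1, h2]
  | op i φ h1 => simp only [Formula.subst, eval, h1]

@[simp] lemma Formula.eval_neg (f : I → H → H) (v : ℕ → H) (φ : Formula I) :
    (neg φ).eval f v = (φ.eval f v)ᶜ := himp_bot _

@[simp] lemma Formula.eval_dual (f : I → H → H) (v : ℕ → H) (i : I) (φ : Formula I) :
    (dual i φ).eval f v = (f i (φ.eval f v)ᶜ)ᶜ := by
  simp [dual, eval]

@[simp] lemma Formula.eval_iff_eq_top (f : I → H → H) (v : ℕ → H) (φ ψ : Formula I) :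
    (iff φ ψ).eval f v = ⊤ ↔ φ.eval f v = ψ.eval f v := by
  simp only [Formula.iff, eval, inf_eq_top_iff, himp_eq_top_iff]
  exact le_antisymm_iff.symm

lemma IPCAxiom.eval_eq_top {φ : Formula I} (h : IPCAxiom φ) (f : I → H → H) (v : ℕ → H) :
    φ.eval f v = ⊤ := by
  cases h with
  | k φ ψ => simp [eval]
  | s φ ψ χ =>
    simp only [eval, himp_eq_top_iff, le_himp_iff]
    set a := eval f v φ
    set b := eval f v ψ
    set c := eval f v χ
    have h1 : (a ⇨ b ⇨ c) ⊓ (a ⇨ b) ⊓ a ≤ b :=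
      (inf_le_inf_right a inf_le_right).trans himp_inf_le
    have h2 : (a ⇨ b ⇨ c) ⊓ (a ⇨ b) ⊓ a ≤ b ⇨ c :=
      (inf_le_inf_right a inf_le_left).trans himp_inf_le
    exact (le_inf h2 h1).trans himp_inf_le
  | and_left φ ψ => simp [eval]
  | and_right φ ψ => simp [eval]
  | and_intro φ ψ => simp [eval]
  | or_left φ ψ => simp [eval]
  | or_right φ ψ => simp [eval]
  | or_elim φ ψ χ =>
    simp only [eval, himp_eq_top_iff, le_himp_iff]
    rw [inf_sup_left]
    exact sup_le ((inf_le_inf_right _ inf_le_left).trans himp_inf_le)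
      ((inf_le_inf_right _ inf_le_right).trans himp_inf_le)
  | exfalso φ => simp [eval]

lemma IsInterior.mono {i : H → H} (h : IsInterior i) {a b : H} (hab : a ≤ b) : i a ≤ i b := by
  have := h.map_inf a b
  rw [inf_eq_left.2 hab] at this
  exact inf_eq_left.1 this.symm

lemma IsInterior.idem {i : H → H} (h : IsInterior i) (a : H) : i (i a) = i a :=
  le_antisymm (h.le_self _) (h.le_idem a)

lemma IsInterior.isSublattice {i : H → H} (h : IsInterior i) :
    IsSublattice {a | i a = a} where
  supClosed := fun a ha b hb => le_antisymm (h.le_self _) (sup_le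
    ((ge_of_eq ha).trans (h.mono le_sup_left)) ((ge_of_eq hb).trans (h.mono le_sup_right)))
  infClosed := fun a (ha : i a = a) b (hb : i b = b) => by
    rw [Set.mem_ofPred_eq, h.map_inf, ha, hb]

lemma IsInterior.map_bot {i : H → H} (h : IsInterior i) : i ⊥ = ⊥ := le_bot_iff.1 (h.le_self _)

lemma IsClosure.mono {c : H → H} (h : IsClosure c) {a b : H} (hab : a ≤ b) : c a ≤ c b := by
  have := h.map_sup a b
  rw [sup_eq_right.2 hab] at this
  exact sup_eq_right.1 this.symm

lemma S4Axiom.eval_eq_top {f : I → H → H} {i : I} (hi : IsInterior (f i)) {φ : Formula I}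
    (h : S4Axiom i φ) (v : ℕ → H) : φ.eval f v = ⊤ := by
  cases h with
  | k φ ψ =>
    simp only [eval, himp_eq_top_iff, le_himp_iff, ← hi.map_inf]
    exact hi.mono himp_inf_le
  | t φ => simpa [eval] using hi.le_self _
  | four φ => simpa [eval] using hi.le_idem _

lemma ClassicalProvable.eval_eq_top {B : Type*} [BooleanAlgebra B] {Ax : Formula I → Prop}
    {f : I → B → B} (hf : ∀ i, f i ⊤ = ⊤) (hAx : ∀ φ, Ax φ → ∀ v, φ.eval f v = ⊤)
    {φ : Formula I} (h : ClassicalProvable Ax φ) : ∀ v, φ.eval f v = ⊤ := by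
  induction h with
  | ipc h => exact h.eval_eq_top f
  | dne φ => intro v; simp [eval]
  | ax h => exact hAx _ h
  | mp _ _ h1 h2 =>
    intro v
    have := h1 v
    rwa [eval, h2 v, top_himp] at this
  | subst s _ h1 => intro v; rw [eval_subst, h1]
  | nec i _ h1 => intro v; rw [eval, h1, hf]

theorem MS4Algebra.valid_of_provable {B : Type*} [BooleanAlgebra B] (A : MS4Algebra B)
    {φ : Formula MS4Op} (h : MS4Provable φ) : A.Valid φ := by
  refine ClassicalProvable.eval_eq_top ?_ ?_ h
  · rintro (_ | _)
    exacts [A.box_s4.map_top, A.all_s4.map_top]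
  · intro φ hφ v
    cases hφ with
    | box h => exact h.eval_eq_top A.box_s4 v
    | all h =>
      cases h with
      | s4 h => exact h.eval_eq_top A.all_s4 v
      | b φ => simpa [eval, MS4Algebra.ops] using A.all_s5 _
    | comm φ => simpa [eval, MS4Algebra.ops] using A.comm _

theorem TS4Algebra.valid_of_provable {B : Type*} [BooleanAlgebra B] (A : TS4Algebra B)
    {φ : Formula TS4Op} (h : TS4Provable φ) : A.Valid φ := by
  refine ClassicalProvable.eval_eq_top ?_ ?_ h
  · rintro (_ | _ | _)
    exacts [A.box_s4.map_top, A.boxF_s4.map_top, A.boxP_s4.map_top]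
  · intro φ hφ v
    cases hφ with
    | box h => exact h.eval_eq_top A.box_s4 v
    | boxF h => exact h.eval_eq_top A.boxF_s4 v
    | boxP h => exact h.eval_eq_top A.boxP_s4 v
    | pf φ => simpa only [eval, eval_dual, himp_eq_top_iff, ops] using A.pf _
    | fp φ => simpa only [eval, eval_dual, himp_eq_top_iff, ops] using A.fp _
    | t1 φ => simpa only [eval, eval_dual, himp_eq_top_iff, ops] using A.t1 _
    | t2 φ => simpa only [eval, eval_dual, himp_eq_top_iff, ops] using A.t2 _

theorem MonadicHeytingAlgebra.valid_of_provable (A : MonadicHeytingAlgebra H)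
    {φ : Formula MIPCOp} (h : MIPCProvable φ) : A.Valid φ := by
  induction h with
  | ipc h => exact h.eval_eq_top _
  | ax h =>
    intro v
    have hex := A.ex_closure
    cases h with
    | all_and φ ψ => simp [eval, ops, A.all_interior.map_inf]
    | all_le φ => simpa [eval, ops] using A.all_interior.le_self _
    | all_all φ => simpa [eval, ops] using A.all_interior.le_idem _
    | ex_or φ ψ => simp [eval, ops, hex.map_sup]
    | le_ex φ => simpa [eval, ops] using hex.self_le _
    | ex_ex φ => simpa [eval, ops] using hex.idem_le _
    | ex_and φ ψ => simp [eval, ops, A.ex_inf]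
    | ex_all φ => simp [eval, ops, A.ex_all]
    | all_ex φ => simp [eval, ops, A.all_ex]
  | mp _ _ h1 h2 =>
    intro v
    have := h1 v
    rwa [eval, h2 v, top_himp] at this
  | subst s _ h1 => intro v; rw [eval_subst, h1]
  | nec _ h1 => intro v; rw [eval, h1]; exact A.all_interior.map_top
  | reg i _ h1 =>
    intro v
    have := himp_eq_top_iff.1 (h1 v)
    rw [eval, himp_eq_top_iff]
    cases i with
    | all => exact A.all_interior.mono this
    | ex => exact A.ex_closure.mono this

end Soundness

/-! ### Complex algebras -/

/-- The box of a relation. -/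
def relBox {X : Type*} (r : X → X → Prop) (A : Set X) : Set X := {x | ∀ y, r x y → y ∈ A}

lemma isInterior_relBox {X : Type*} {r : X → X → Prop} (hr : ∀ x, r x x)
    (ht : ∀ x y z, r x y → r y z → r x z) : IsInterior (relBox r) where
  map_inf _ _ := Set.ext fun _ =>
    ⟨fun h => ⟨fun y hy => (h y hy).1, fun y hy => (h y hy).2⟩,
      fun h y hy => ⟨h.1 y hy, h.2 y hy⟩⟩
  map_top := Set.ext fun _ => ⟨fun _ => trivial, fun _ _ _ => trivial⟩
  le_self _ x h := h x (hr x)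
  le_idem _ x h y hy z hz := h z (ht x y z hy hz)

lemma mem_compl_relBox_compl {X : Type*} {r : X → X → Prop} {A : Set X} {x : X} :
    x ∈ (relBox r Aᶜ)ᶜ ↔ ∃ y, r x y ∧ y ∈ A := by
  simp [relBox]

lemma Formula.eval_relBox {I : Type} {X : Type*} {rel : I → X → X → Prop}
    {f : I → Set X → Set X} (hf : ∀ i, f i = relBox (rel i)) (v : ℕ → Set X) (φ : Formula I) :
    φ.eval f v = {x | φ.Sat rel v x} := by
  induction φ with
  | letter n => rfl
  | bot => rfl
  | and φ ψ h1 h2 => rw [eval, h1, h2]; rfl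
  | or φ ψ h1 h2 => rw [eval, h1, h2]; rfl
  | imp φ ψ h1 h2 =>
    rw [eval, h1, h2, himp_eq]
    ext x
    simp only [Sat, Set.mem_ofPred_eq, Set.sup_eq_union, Set.mem_union, Set.mem_compl_iff]
    tauto
  | op i φ h => rw [eval, h, hf]; rfl

/-- The complex algebra of an `MS4`-frame. -/
def MS4Frame.complexAlgebra {X : Type*} (F : MS4Frame X) : MS4Algebra (Set X) where
  box := relBox F.R
  all := relBox F.E
  box_s4 := isInterior_relBox F.R_refl F.R_trans
  all_s4 := isInterior_relBox F.E_equiv.refl fun _ _ _ => F.E_equiv.trans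
  all_s5 A x hx y hy := mem_compl_relBox_compl.2 ⟨x, F.E_equiv.symm hy, hx⟩
  comm A x hx y hy z hz := by
    obtain ⟨u, hu, huz⟩ := F.comm x y z hy hz
    exact hx u hu z huz

lemma MS4Frame.not_valid_complexAlgebra {X : Type*} (F : MS4Frame X) {φ : Formula MS4Op}
    (h : ¬ F.Valid φ) : ¬ F.complexAlgebra.Valid φ := fun h1 => h fun v x => by
  have := h1 v
  rw [Formula.eval_relBox (rel := F.rel) (by rintro (_ | _) <;> rfl)] at this
  exact (Set.ext_iff.1 this x).2 trivial

/-- The complex algebra of a `TS4`-frame. -/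
def TS4Frame.complexAlgebra {X : Type*} (F : TS4Frame X) : TS4Algebra (Set X) where
  box := relBox F.R
  boxF := relBox F.Q
  boxP := relBox fun x y => F.Q y x
  box_s4 := isInterior_relBox F.R_refl F.R_trans
  boxF_s4 := isInterior_relBox F.Q_refl F.Q_trans
  boxP_s4 := isInterior_relBox F.Q_refl fun x y z h1 h2 => F.Q_trans z y x h2 h1
  pf A x hx y hy := mem_compl_relBox_compl.2 ⟨x, hy, hx⟩
  fp A x hx y hy := mem_compl_relBox_compl.2 ⟨x, hy, hx⟩
  t1 A x hx := by
    obtain ⟨y, hy, hyA⟩ := mem_compl_relBox_compl.1 hx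
    exact mem_compl_relBox_compl.2 ⟨y, F.R_sub_Q x y hy, hyA⟩
  t2 A x hx := by
    obtain ⟨y, hy, hyA⟩ := mem_compl_relBox_compl.1 hx
    -- The point `z` is `Q`-equivalent to `y ∈ A`, hence sees `A` both forwards and backwards along
    -- `Q`.
    obtain ⟨z, hz, hzy, hyz⟩ := F.exists_of_Q x y hy
    exact mem_compl_relBox_compl.2 ⟨z, hz, mem_compl_relBox_compl.2 ⟨y, hzy, hyA⟩,
      mem_compl_relBox_compl.2 ⟨y, hyz, hyA⟩⟩

lemma TS4Frame.not_valid_complexAlgebra {X : Type*} (F : TS4Frame X) {φ : Formula TS4Op}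
    (h : ¬ F.Valid φ) : ¬ F.complexAlgebra.Valid φ := fun h1 => h fun v x => by
  have := h1 v
  rw [Formula.eval_relBox (rel := F.rel) (by rintro (_ | _ | _) <;> rfl)] at this
  exact (Set.ext_iff.1 this x).2 trivial

/-! ### Algebras of upsets of `MIPC`-frames -/

namespace MIPCFrame

variable {X : Type*} (F : MIPCFrame X)

/-- The points of an `MIPC`-frame, ordered by the converse of `R`. -/
def Carrier (_ : MIPCFrame X) : Type _ := X

/-- The order is reversed because `LowerSet` is ordered by inclusion and `UpperSet` by reverse
inclusion: `R`-upsets become lower sets with the intended order. -/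
instance : Preorder F.Carrier where
  le x y := F.R y x
  le_refl := F.R_refl
  le_trans x y z h1 h2 := F.R_trans z y x h2 h1

/-- The algebra of `R`-upsets. -/
abbrev Upset : Type _ := LowerSet F.Carrier

/-- The adjunction defining `⇨` is tested on the principal lower set of `x`. -/
lemma mem_himp_iff {a b : F.Upset} {x : F.Carrier} :
    x ∈ a ⇨ b ↔ ∀ y : F.Carrier, F.R x y → y ∈ a → y ∈ b := by
  rw [← LowerSet.Iic_le, le_himp_iff]
  exact ⟨fun h y hy hya => h ⟨hy, hya⟩, fun h y hy => h y hy.1 hy.2⟩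

/-- The universal quantifier on upsets. -/
def upsetAll (a : F.Upset) : F.Upset where
  carrier := {x | ∀ y : F.Carrier, F.Q x y → y ∈ a}
  lower' x x' h hx y hy := hx y (F.Q_trans x x' y (F.R_sub_Q x x' h) hy)

/-- The existential quantifier on upsets. -/
def upsetEx (a : F.Upset) : F.Upset where
  carrier := {x | ∃ y : F.Carrier, (F.Q x y ∧ F.Q y x) ∧ y ∈ a}
  lower' := by
    rintro x x' h ⟨y, hy, hya⟩
    -- The witness `y` for `x` is moved along `R` into the `Q`-cluster of `x'`; it stays in `a`
    -- because `a` is an upset.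
    obtain ⟨z, hz, hz1, hz2⟩ := F.exists_of_Q y x' (F.Q_trans y x x' hy.2 (F.R_sub_Q x x' h))
    exact ⟨z, ⟨hz2, hz1⟩, a.lower hz hya⟩

lemma mem_upsetAll {a : F.Upset} {x : F.Carrier} :
    x ∈ F.upsetAll a ↔ ∀ y : F.Carrier, F.Q x y → y ∈ a := Iff.rfl

lemma mem_upsetEx {a : F.Upset} {x : F.Carrier} :
    x ∈ F.upsetEx a ↔ ∃ y : F.Carrier, (F.Q x y ∧ F.Q y x) ∧ y ∈ a := Iff.rfl

/-- The complex algebra of an `MIPC`-frame. -/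
def complexAlgebra : MonadicHeytingAlgebra F.Upset where
  all := F.upsetAll
  ex := F.upsetEx
  all_interior :=
    { map_inf := fun a b => by
        ext x
        exact forall₂_and
      map_top := by
        ext x
        simp [mem_upsetAll]
      le_self := fun a x h => h x (F.Q_refl x)
      le_idem := fun a x h y hy z hz => h z (F.Q_trans x y z hy hz) }
  ex_closure :=
    { map_sup := fun a b => by
        ext x
        simp only [SetLike.mem_coe, mem_upsetEx, LowerSet.mem_sup_iff, and_or_left, exists_or]
      map_bot := by
        ext x
        simp [mem_upsetEx]
      self_le := fun a x h => ⟨x, ⟨F.Q_refl x, F.Q_refl x⟩, h⟩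
      idem_le := fun a x ⟨y, hy, z, hz, h⟩ =>
        ⟨z, ⟨F.Q_trans x y z hy.1 hz.1, F.Q_trans z y x hz.2 hy.2⟩, h⟩ }
  ex_inf a b := by
    ext x
    simp only [SetLike.mem_coe, mem_upsetEx, LowerSet.mem_inf_iff]
    constructor
    · rintro ⟨y, hy, ⟨z, hz, hza⟩, hyb⟩
      exact ⟨⟨z, ⟨F.Q_trans x y z hy.1 hz.1, F.Q_trans z y x hz.2 hy.2⟩, hza⟩, y, hy, hyb⟩
    · rintro ⟨⟨z, hz, hza⟩, y, hy, hyb⟩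
      exact ⟨y, hy, ⟨z, ⟨F.Q_trans y x z hy.2 hz.1, F.Q_trans z x y hz.2 hy.1⟩, hza⟩, hyb⟩
  all_ex a := by
    ext x
    simp only [SetLike.mem_coe, mem_upsetEx, mem_upsetAll]
    refine ⟨fun h => h x (F.Q_refl x), ?_⟩
    rintro ⟨y, hy, hya⟩ z hz
    obtain ⟨w, hw, hw1, hw2⟩ := F.exists_of_Q y z (F.Q_trans y x z hy.2 hz)
    exact ⟨w, ⟨hw2, hw1⟩, a.lower hw hya⟩
  ex_all a := by
    ext x
    simp only [SetLike.mem_coe, mem_upsetEx, mem_upsetAll]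
    refine ⟨?_, fun h => ⟨x, ⟨F.Q_refl x, F.Q_refl x⟩, h⟩⟩
    rintro ⟨y, hy, h⟩ z hz
    exact h z (F.Q_trans y x z hy.2 hz)

lemma mem_eval_iff (v : ℕ → F.Upset) (φ : Formula MIPCOp) (x : F.Carrier) :
    x ∈ φ.eval F.complexAlgebra.ops v ↔ F.Sat (fun n => (v n : Set F.Carrier)) φ x := by
  induction φ generalizing x with
  | letter n => rfl
  | bot => rfl
  | and φ ψ h1 h2 => exact and_congr (h1 x) (h2 x)
  | or φ ψ h1 h2 => exact or_congr (h1 x) (h2 x)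
  | imp φ ψ h1 h2 =>
    rw [eval, mem_himp_iff]
    exact forall_congr' fun y => imp_congr_right fun _ => imp_congr (h1 y) (h2 y)
  | op i φ h =>
    cases i with
    | all =>
      refine F.mem_upsetAll.trans ?_
      simp only [h]
      rfl
    | ex =>
      refine F.mem_upsetEx.trans ?_
      simp only [h]
      rfl

lemma not_valid_complexAlgebra {φ : Formula MIPCOp} (h : ¬ F.Valid φ) :
    ¬ F.complexAlgebra.Valid φ := fun h1 => h fun v hv x => by
  let w : ℕ → F.Upset := fun n => ⟨v n, fun x y hxy hx => hv n x y hx hxy⟩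
  refine (F.mem_eval_iff w φ x).1 ?_
  rw [h1 w]
  trivial

end MIPCFrame

/-! ### Finite frames refuting formulas -/

/-- Here `D` contains all subformula values but need not be closed under `⇨` or `∀`. The truth lemma
uses those operations only on values already in `D`; the missing worlds come from the prime filter
theorem in `H`. -/
theorem MonadicHeytingAlgebra.exists_finite_frame {H : Type} [HeytingAlgebra H]
    (A : MonadicHeytingAlgebra H) {φ : Formula MIPCOp} (h : ¬ A.Valid φ) :
    ∃ (X : Type) (_ : Finite X) (F : MIPCFrame X), ¬ F.Valid φ := by
  obtain ⟨v, hv⟩ := not_forall.1 h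
  have hall := A.all_interior
  have hex := A.ex_closure
  obtain ⟨D, hDfin, hSD, -, hD, hDt, hDb, hDe⟩ := exists_finite_sublattice
    (U := Set.univ) isSublattice_univ trivial trivial (e := A.ex) (fun _ _ => trivial)
    (fun a _ b _ => hex.map_sup a b) (fun a _ => hex.self_le a)
    (fun a _ b _ => A.ex_inf a b) (finite_subvalues A.ops v φ) (Set.subset_univ _)
  set G : Set H := D ∩ {b | A.all b = b} with hGdef
  have hG : IsSublattice G := hD.inter hall.isSublattice
  have hGt : ⊤ ∈ G := ⟨hDt, hall.map_top⟩
  have hGb : ⊥ ∈ G := ⟨hDb, hall.map_bot⟩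
  have hexG : ∀ u ∈ D, A.ex u ∈ G := fun u hu => ⟨hDe u hu, A.all_ex u⟩
  have hGex : ∀ b ∈ G, A.ex b = b := fun b hb => by
    have := A.ex_all b
    rwa [show A.all b = b from hb.2] at this
  -- Since `b` and `c` are also fixed by `∃`, the law `∃(∃b ∧ u) = ∃b ∧ ∃u` reduces this to
  -- monotonicity.
  have hle : ∀ u, ∀ b ∈ G, ∀ c ∈ G, u ⊓ b ≤ c → A.ex u ⊓ b ≤ c := by
    intro u b hb c hc huc
    have := A.ex_inf b u
    rw [hGex b hb, inf_comm, inf_comm b] at this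
    rw [← this, ← hGex c hc]
    exact hex.mono huc
  let F : MIPCFrame (Trace D) :=
    { R := fun s t => ∀ u ∈ D, s.rep u → t.rep u
      Q := fun s t => ∀ u ∈ G, s.rep u → t.rep u
      R_refl := fun _ _ _ => id
      R_trans := fun _ _ _ h1 h2 u hu h => h2 u hu (h1 u hu h)
      Q_refl := fun _ _ _ => id
      Q_trans := fun _ _ _ h1 h2 u hu h => h2 u hu (h1 u hu h)
      R_sub_Q := fun _ _ h u hu => h u hu.1
      R_antisymm := fun _ _ h1 h2 => Trace.ext fun a ha => ⟨h1 a ha, h2 a ha⟩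
      exists_of_Q := by
        intro s t hst
        obtain ⟨x, h1, h2⟩ := Point.exists_amalgam hD.2 hDt hG hGt hGb (e := A.ex)
          (fun u _ => hle u) s.rep t.rep
          fun u hu hsu => hst _ (hexG u hu) (s.rep.mono (hex.self_le u) hsu)
        exact ⟨Trace.mk D x, fun u hu hsu => (Trace.rep_mk x hu).2 (h1 u hu hsu),
          fun u hu h => (h2 u hu).1 ((Trace.rep_mk x hu.1).1 h),
          fun u hu h => (Trace.rep_mk x hu.1).2 ((h2 u hu).2 h)⟩ }
  refine ⟨Trace D, Trace.finite hDfin, F, fun hF => ?_⟩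
  -- `R` only controls elements of `D`, so the conjunct `v n ∈ D` is what makes the valuation of
  -- every letter an upset; letters with value outside `D` become empty.
  have key : ∀ ψ : Formula MIPCOp, subvalues A.ops v ψ ⊆ D → ∀ t : Trace D,
      F.Sat (fun n => {s | v n ∈ D ∧ s.rep (v n)}) ψ t ↔ t.rep (eval A.ops v ψ) := by
    intro ψ hψ
    induction ψ with
    | letter n => exact fun t => and_iff_right (hψ rfl)
    | bot => exact fun t => iff_of_false id t.rep.not_bot
    | and φ ψ h1 h2 =>
      obtain ⟨h3, h4⟩ := Set.union_subset_iff.1 (Set.insert_subset_iff.1 hψ).2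
      intro t
      simp only [MIPCFrame.Sat, eval, Point.inf_iff, h1 h3, h2 h4]
    | or φ ψ h1 h2 =>
      obtain ⟨h3, h4⟩ := Set.union_subset_iff.1 (Set.insert_subset_iff.1 hψ).2
      intro t
      simp only [MIPCFrame.Sat, eval, Point.sup_iff, h1 h3, h2 h4]
    | imp φ ψ h1 h2 =>
      obtain ⟨hD1, h5⟩ := Set.insert_subset_iff.1 hψ
      obtain ⟨h3, h4⟩ := Set.union_subset_iff.1 h5
      have ha := h3 (eval_mem_subvalues A.ops v φ)
      have hb := h4 (eval_mem_subvalues A.ops v ψ)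
      intro t
      simp only [MIPCFrame.Sat, eval, h1 h3, h2 h4]
      simp only [eval] at hD1
      refine ⟨fun hst => by_contra fun hn => ?_, fun ht s hs hsa =>
        s.rep.mono himp_inf_le ((s.rep.inf_iff _ _).2 ⟨hs _ hD1 ht, hsa⟩)⟩
      -- An `R`-successor containing the antecedent but not the consequent: `u ⊓ a ≤ b` with `u` in
      -- `t` would put `a ⇨ b` into `t`.
      obtain ⟨x, hx, hxb⟩ := Point.exists_not_of_forall_not_le
        (P := {p | ∃ u ∈ D, t.rep u ∧ p = u ⊓ eval A.ops v φ}) (a := eval A.ops v ψ)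
        (by
          rintro _ ⟨u, hu, htu, rfl⟩ _ ⟨w, hw, htw, rfl⟩
          exact ⟨u ⊓ w, hD.2 hu hw, (t.rep.inf_iff _ _).2 ⟨htu, htw⟩,
            (inf_inf_distrib_right _ _ _).symm⟩)
        ⟨_, ⊤, hDt, t.rep.top, rfl⟩
        (by
          rintro _ ⟨u, hu, htu, rfl⟩ hle
          exact hn (t.rep.mono (le_himp_iff.2 hle) htu))
      refine hxb ((Trace.rep_mk x hb).1 (hst (Trace.mk D x) ?_ ?_))
      · exact fun u hu htu => (Trace.rep_mk x hu).2
          (x.mono inf_le_left (hx _ ⟨u, hu, htu, rfl⟩))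
      · exact (Trace.rep_mk x ha).2 (x.mono inf_le_right (hx _ ⟨⊤, hDt, t.rep.top, rfl⟩))
    | op i φ h1 =>
      obtain ⟨hD1, h3⟩ := Set.insert_subset_iff.1 hψ
      have ha := h3 (eval_mem_subvalues A.ops v φ)
      intro t
      cases i with
      | all =>
        simp only [MIPCFrame.Sat, eval, h1 h3]
        refine ⟨fun hst => by_contra fun hn => ?_, fun ht s hs =>
          s.rep.mono (hall.le_self _) (hs _ ⟨hD1, hall.idem _⟩ ht)⟩
        obtain ⟨x, hx, hxa⟩ := Point.exists_not_of_forall_not_le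
          (P := {p | p ∈ G ∧ t.rep p}) (a := eval A.ops v φ)
          (by
            rintro p ⟨hp, htp⟩ q ⟨hq, htq⟩
            exact ⟨hG.2 hp hq, (t.rep.inf_iff _ _).2 ⟨htp, htq⟩⟩)
          ⟨⊤, hGt, t.rep.top⟩
          (by
            rintro p ⟨hp, htp⟩ hle
            exact hn (t.rep.mono ((ge_of_eq hp.2).trans (hall.mono hle)) htp))
        exact hxa ((Trace.rep_mk x ha).1 (hst (Trace.mk D x)
          fun u hu htu => (Trace.rep_mk x hu.1).2 (hx u ⟨hu, htu⟩)))
      | ex =>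
        simp only [MIPCFrame.Sat, eval, h1 h3]
        refine ⟨?_, fun ht => ?_⟩
        · rintro ⟨s, ⟨-, hs⟩, hsa⟩
          exact hs _ (hexG _ ha) (s.rep.mono (hex.self_le _) hsa)
        -- The witness for `∃` must contain the value of `φ` and have exactly the `G`-part of `t`.
        -- An obstruction `a ⊓ b ≤ c` gives `∃a ⊓ b ≤ c`, contradicting `c ∉ t`.
        obtain ⟨x, hx1, hx2⟩ := Point.exists_of_forall_not_le
          (P := {p | ∃ b ∈ G, t.rep b ∧ p = eval A.ops v φ ⊓ b}) (N := {c | c ∈ G ∧ ¬ t.rep c})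
          (by
            rintro _ ⟨u, hu, htu, rfl⟩ _ ⟨w, hw, htw, rfl⟩
            exact ⟨u ⊓ w, hG.2 hu hw, (t.rep.inf_iff _ _).2 ⟨htu, htw⟩,
              (inf_inf_distrib_left _ _ _).symm⟩)
          ⟨_, ⊤, hGt, t.rep.top, rfl⟩
          (by
            rintro c ⟨hc, htc⟩ d ⟨hd, htd⟩
            exact ⟨hG.1 hc hd, by simp [htc, htd]⟩)
          ⟨⊥, hGb, t.rep.not_bot⟩
          (by
            rintro _ ⟨b, hb, htb, rfl⟩ c ⟨hc, htc⟩ hbc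
            exact htc (t.rep.mono (hle _ b hb c hc hbc) ((t.rep.inf_iff _ _).2 ⟨ht, htb⟩)))
        refine ⟨Trace.mk D x, ⟨fun u hu htu => ?_, fun u hu hxu => ?_⟩, ?_⟩
        · exact (Trace.rep_mk x hu.1).2 (x.mono inf_le_right (hx1 _ ⟨u, hu, htu, rfl⟩))
        · exact by_contra fun htu => hx2 u ⟨hu, htu⟩ ((Trace.rep_mk x hu.1).1 hxu)
        · exact (Trace.rep_mk x ha).2 (x.mono inf_le_left (hx1 _ ⟨⊤, hGt, t.rep.top, rfl⟩))
  have hvalid := hF (fun n => {s | v n ∈ D ∧ s.rep (v n)})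
    (fun n s t hs hst => ⟨hs.1, hst _ hs.1 hs.2⟩)
  apply hv
  by_contra hne
  obtain ⟨x, hx⟩ := Point.exists_not_of_ne_top hne
  exact hx ((Trace.rep_mk x (hSD (eval_mem_subvalues A.ops v φ))).1
    ((key φ hSD _).1 (hvalid _)))

/-- Reduces the classical logics to checking the truth condition of each operator on subformula
values. -/
lemma Formula.exists_not_sat {B I : Type} [BooleanAlgebra B] {f : I → B → B} {v : ℕ → B}
    {F : Set B} {rel : I → Trace F → Trace F → Prop} {φ : Formula I}
    (hF : subvalues f v φ ⊆ F)
    (hrel : ∀ i, ∀ a ∈ subvalues f v φ, f i a ∈ subvalues f v φ → ∀ t : Trace F,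
      t.rep (f i a) ↔ ∀ s, rel i t s → s.rep a) (hv : φ.eval f v ≠ ⊤) :
    ∃ (w : ℕ → Set (Trace F)) (t : Trace F), ¬ φ.Sat rel w t := by
  obtain ⟨x, hx⟩ := Point.exists_not_of_ne_top hv
  exact ⟨_, Trace.mk F x, fun h => hx ((Trace.rep_mk x (hF (eval_mem_subvalues f v φ))).1
    ((sat_iff_rep_eval f v hrel φ le_rfl _).1 h))⟩

/-- The truth condition for an interior operator with respect to a set of its fixed points. -/
lemma IsInterior.rep_iff {B : Type*} [BooleanAlgebra B] {i : B → B} (hi : IsInterior i)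
    {F D : Set B} (hDF : D ⊆ F) (hD : IsSublattice D) (hDt : ⊤ ∈ D) (hDi : ∀ u ∈ D, i u = u)
    {a : B} (ha : a ∈ F) (hia : i a ∈ D) (t : Trace F) :
    t.rep (i a) ↔ ∀ s : Trace F, (∀ u ∈ D, t.rep u → s.rep u) → s.rep a := by
  refine ⟨fun h s hs => s.rep.mono (hi.le_self a) (hs _ hia h),
    fun h => by_contra fun hn => ?_⟩
  -- A fixed point below `a` is already below `i a`, so the `D`-part of `t` generates a filter
  -- avoiding `a`.
  obtain ⟨x, hx, hxa⟩ := Point.exists_not_of_forall_not_le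
    (P := {p | p ∈ D ∧ t.rep p}) (a := a)
    (by
      rintro p ⟨hp, htp⟩ q ⟨hq, htq⟩
      exact ⟨hD.2 hp hq, (t.rep.inf_iff _ _).2 ⟨htp, htq⟩⟩)
    ⟨⊤, hDt, t.rep.top⟩
    (by
      rintro p ⟨hp, htp⟩ hle
      exact hn (t.rep.mono ((ge_of_eq (hDi p hp)).trans (hi.mono hle)) htp))
  exact hxa ((Trace.rep_mk x ha).1 (h (Trace.mk F x)
    fun u hu htu => (Trace.rep_mk x (hDF hu)).2 (hx u ⟨hu, htu⟩)))

/-! ### Finite frames for `MS4` -/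

namespace MS4Algebra

variable {B : Type*} [BooleanAlgebra B] (A : MS4Algebra B)

/-- The dual of `∀`. -/
def ex (a : B) : B := (A.all aᶜ)ᶜ

lemma all_compl {b : B} (hb : A.all b = b) : A.all bᶜ = bᶜ := by
  refine le_antisymm (A.all_s4.le_self _) ?_
  have := A.all_s5 bᶜ
  rwa [compl_compl, hb] at this

lemma all_ex (a : B) : A.all (A.ex a) = A.ex a := A.all_compl (A.all_s4.idem _)

lemma le_ex (a : B) : a ≤ A.ex a := le_compl_comm.1 (A.all_s4.le_self aᶜ)

lemma ex_le {a b : B} (hb : A.all b = b) (h : a ≤ b) : A.ex a ≤ b := by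
  rw [ex, compl_le_iff_compl_le, ← A.all_compl hb]
  exact A.all_s4.mono (compl_le_compl h)

/-- By S5 the fixed points of `∀` are closed under complement, so `b ⇨ c` is one of them, and `∃u`
is the least one above `u`. This is the hypothesis of amalgamation. -/
lemma ex_inf_le {u b c : B} (hb : A.all b = b) (hc : A.all c = c) (h : u ⊓ b ≤ c) :
    A.ex u ⊓ b ≤ c := by
  rw [← le_himp_iff] at h ⊢
  refine A.ex_le ?_ h
  rw [himp_eq]
  exact A.all_s4.isSublattice.1 hc (A.all_compl hb)

lemma ex_sup (a b : B) : A.ex (a ⊔ b) = A.ex a ⊔ A.ex b := by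
  rw [ex, compl_sup, A.all_s4.map_inf, compl_inf]; rfl

lemma ex_ex_inf (a b : B) : A.ex (A.ex a ⊓ b) = A.ex a ⊓ A.ex b := by
  apply le_antisymm
  · exact A.ex_le (A.all_s4.isSublattice.2 (A.all_ex a) (A.all_ex b))
      (inf_le_inf_left _ (A.le_ex b))
  · rw [inf_comm]
    exact A.ex_inf_le (A.all_ex a) (A.all_ex _) (inf_comm b _ ▸ A.le_ex _)

/-- The axiom `□∀a ≤ ∀□a` makes `□∃u` fixed by `∀`; it lies above `u = □u`, hence above `∃u`. -/
lemma box_ex {u : B} (hu : A.box u = u) : A.box (A.ex u) = A.ex u := by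
  refine le_antisymm (A.box_s4.le_self _) (A.ex_le ?_ ?_)
  · refine le_antisymm (A.all_s4.le_self _) ?_
    have := A.comm (A.ex u)
    rwa [A.all_ex] at this
  · exact (ge_of_eq hu).trans (A.box_s4.mono (A.le_ex u))

theorem exists_finite_frame {B : Type} [BooleanAlgebra B] (A : MS4Algebra B)
    {φ : Formula MS4Op} (h : ¬ A.Valid φ) :
    ∃ (X : Type) (_ : Finite X) (F : MS4Frame X), ¬ F.Valid φ := by
  obtain ⟨v, hv⟩ := not_forall.1 h
  obtain ⟨F, hFfin, hSF, -, hF, hFt, hFb, hFe⟩ := exists_finite_sublattice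
    (U := Set.univ) isSublattice_univ trivial trivial (e := A.ex) (fun _ _ => trivial)
    (fun a _ b _ => A.ex_sup a b) (fun a _ => A.le_ex a)
    (fun a _ b _ => A.ex_ex_inf a b) (finite_subvalues A.ops v φ) (Set.subset_univ _)
  set D : Set B := F ∩ {b | A.box b = b} with hDdef
  set G : Set B := F ∩ {b | A.all b = b} with hGdef
  have hD : IsSublattice D := hF.inter A.box_s4.isSublattice
  have hG : IsSublattice G := hF.inter A.all_s4.isSublattice
  have hDt : ⊤ ∈ D := ⟨hFt, A.box_s4.map_top⟩
  have hGt : ⊤ ∈ G := ⟨hFt, A.all_s4.map_top⟩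
  have hGb : ⊥ ∈ G := ⟨hFb, A.all_s4.map_bot⟩
  have hexD : ∀ u ∈ D, A.ex u ∈ D := fun u hu => ⟨hFe u hu.1, A.box_ex hu.2⟩
  have hexG : ∀ u ∈ D, A.ex u ∈ G := fun u hu => ⟨hFe u hu.1, A.all_ex u⟩
  let M : MS4Frame (Trace F) :=
    { R := fun s t => ∀ u ∈ D, s.rep u → t.rep u
      E := fun s t => ∀ u ∈ G, s.rep u ↔ t.rep u
      R_refl := fun _ _ _ => id
      R_trans := fun _ _ _ h1 h2 u hu h => h2 u hu (h1 u hu h)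
      E_equiv := ⟨fun _ _ _ => Iff.rfl, fun h u hu => (h u hu).symm,
        fun h1 h2 u hu => (h1 u hu).trans (h2 u hu)⟩
      comm := by
        intro s t w hst htw
        obtain ⟨x, h1, h2⟩ := Point.exists_amalgam hD.2 hDt hG hGt hGb (e := A.ex)
          (fun u _ b hb c hc => A.ex_inf_le hb.2 hc.2) s.rep w.rep
          -- `∃u` lies in both `G` and `D`, so it passes from `s` to `t` along `E` and from `t` to
          -- `w` along `R`.
          fun u hu hsu => htw _ (hexD u hu)
            ((hst _ (hexG u hu)).1 (s.rep.mono (A.le_ex u) hsu))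
        exact ⟨Trace.mk F x, fun u hu hsu => (Trace.rep_mk x hu.1).2 (h1 u hu hsu),
          fun u hu => (Trace.rep_mk x hu.1).trans (h2 u hu)⟩ }
  obtain ⟨w, t, ht⟩ := Formula.exists_not_sat (f := A.ops) (rel := M.rel) hSF (by
    rintro (_ | _) a ha hia t
    · exact A.box_s4.rep_iff Set.inter_subset_left hD hDt (fun u hu => hu.2) (hSF ha)
        ⟨hSF hia, A.box_s4.idem a⟩ t
    · have hall : A.all a ∈ G := ⟨hSF hia, A.all_s4.idem a⟩
      refine ⟨fun h s hs => s.rep.mono (A.all_s4.le_self a) ((hs _ hall).1 h),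
        fun h => by_contra fun hn => ?_⟩
      obtain ⟨x, h1, h2⟩ := Point.exists_of_forall_not_le
        (P := {p | p ∈ G ∧ t.rep p}) (N := {p | ∃ c ∈ G, ¬ t.rep c ∧ p = a ⊔ c})
        (by
          rintro p ⟨hp, htp⟩ q ⟨hq, htq⟩
          exact ⟨hG.2 hp hq, (t.rep.inf_iff _ _).2 ⟨htp, htq⟩⟩)
        ⟨⊤, hGt, t.rep.top⟩
        (by
          rintro _ ⟨c, hc, htc, rfl⟩ _ ⟨d, hd, htd, rfl⟩
          exact ⟨c ⊔ d, hG.1 hc hd, by simp [htc, htd], (sup_sup_distrib_left _ _ _).symm⟩)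
        ⟨_, ⊥, hGb, t.rep.not_bot, rfl⟩
        (by
          rintro p ⟨hp, htp⟩ _ ⟨c, hc, htc, rfl⟩ hle
          -- `G` need not contain `cᶜ`; it suffices that `p ⊓ cᶜ` is fixed by `∀` in `B` and holds
          -- at the point `t.rep`.
          have hfix : A.all (p ⊓ cᶜ) = p ⊓ cᶜ :=
            A.all_s4.isSublattice.2 hp.2 (A.all_compl hc.2)
          have : p ⊓ cᶜ ≤ A.all a := by
            rw [← hfix]
            refine A.all_s4.mono ?_
            rw [← sdiff_eq, sdiff_le_iff, sup_comm]
            exact hle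
          exact hn (t.rep.mono this
            ((t.rep.inf_iff _ _).2 ⟨htp, (t.rep.compl_iff _).2 htc⟩)))
      refine h2 _ ⟨⊥, hGb, t.rep.not_bot, rfl⟩ (x.mono le_sup_left
        ((Trace.rep_mk x (hSF ha)).1 (h (Trace.mk F x) fun u hu => ?_)))
      refine Iff.trans ⟨fun htu => h1 u ⟨hu, htu⟩, fun hxu => ?_⟩ (Trace.rep_mk x hu.1).symm
      exact by_contra fun htu => h2 _ ⟨u, hu, htu, rfl⟩ (x.mono le_sup_right hxu)) hv
  exact ⟨Trace F, Trace.finite hFfin, M, fun h => ht (h w t)⟩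

end MS4Algebra

/-! ### Finite frames for `TS4` -/

namespace TS4Algebra

variable {B : Type*} [BooleanAlgebra B] (A : TS4Algebra B)

/-- The dual of `■_P`. -/
def diaP (a : B) : B := (A.boxP aᶜ)ᶜ

lemma le_diaP (a : B) : a ≤ A.diaP a := le_compl_comm.1 (A.boxP_s4.le_self aᶜ)

lemma diaP_mono {a b : B} (h : a ≤ b) : A.diaP a ≤ A.diaP b :=
  compl_le_compl (A.boxP_s4.mono (compl_le_compl h))

/-- The tense axioms make `◆_P` left adjoint to `■_F`. With `boxF_diaP`, `◆_P a` is the least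
`■_F`-fixed element above `a`. -/
lemma diaP_le {a b : B} (hb : A.boxF b = b) (h : a ≤ b) : A.diaP a ≤ b := by
  refine (A.diaP_mono h).trans ?_
  have := A.pf bᶜ
  rw [compl_compl, hb] at this
  exact compl_le_iff_compl_le.2 this

lemma boxF_diaP (a : B) : A.boxF (A.diaP a) = A.diaP a := by
  refine le_antisymm (A.boxF_s4.le_self _) ((A.fp (A.diaP a)).trans (A.boxF_s4.mono ?_))
  rw [diaP, compl_compl]
  exact compl_le_compl (A.boxP_s4.le_idem _)

lemma boxF_le_box (a : B) : A.boxF a ≤ A.box a := by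
  have := A.t1 aᶜ
  rwa [compl_compl, compl_le_compl_iff_le] at this

lemma box_eq_of_boxF_eq {b : B} (hb : A.boxF b = b) : A.box b = b :=
  le_antisymm (A.box_s4.le_self _) ((ge_of_eq hb).trans (A.boxF_le_box b))

/-- Put `p = b ∧ ¬c`. From `◆_P p ≤ b` and `c ≤ ■_F ¬p`, `u` is disjoint from `◆_F p ∧ ◆_P p`. As
`u` is `□`-fixed, the last TS4 axiom gives `u ≤ ■_F ¬p`, and adjointness gives `◆_P u ≤ ¬p`. -/
lemma diaP_inf_le {u b c : B} (hu : A.box u = u) (hb : A.boxF b = b) (hc : A.boxF c = c)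
    (h : u ⊓ b ≤ c) : A.diaP u ⊓ b ≤ c := by
  set p := b ⊓ cᶜ with hp
  set q := (A.boxF pᶜ)ᶜ ⊓ A.diaP p with hq
  have h1 : u ⊓ A.diaP p ≤ c := (inf_le_inf_left u (A.diaP_le hb inf_le_left)).trans h
  have h2 : c ≤ A.boxF pᶜ :=
    (ge_of_eq hc).trans (A.boxF_s4.mono (le_compl_comm.1 inf_le_right))
  have h3 : u ≤ qᶜ := by
    rw [le_compl_iff_disjoint_right, disjoint_iff_inf_le, hq, inf_left_comm]
    exact (inf_le_inf_left _ (h1.trans h2)).trans (compl_inf_self _).le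
  have h4 : u ≤ A.boxF pᶜ := by
    have := A.t2 p
    rw [compl_le_compl_iff_le] at this
    exact ((ge_of_eq hu).trans (A.box_s4.mono h3)).trans this
  have h5 : A.diaP u ≤ pᶜ :=
    (A.diaP_le (A.boxF_s4.idem _) h4).trans (A.boxF_s4.le_self _)
  rwa [hp, compl_inf, compl_compl, sup_comm, ← himp_eq, le_himp_iff] at h5

lemma diaP_sup (a b : B) : A.diaP (a ⊔ b) = A.diaP a ⊔ A.diaP b := by
  rw [diaP, compl_sup, A.boxP_s4.map_inf, compl_inf]; rfl

lemma diaP_diaP_inf (a : B) {b : B} (hb : A.box b = b) :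
    A.diaP (A.diaP a ⊓ b) = A.diaP a ⊓ A.diaP b := by
  apply le_antisymm
  · exact le_inf (A.diaP_le (A.boxF_diaP a) inf_le_left) (A.diaP_mono inf_le_right)
  · rw [inf_comm]
    exact A.diaP_inf_le hb (A.boxF_diaP a) (A.boxF_diaP _) (inf_comm b _ ▸ A.le_diaP _)

theorem exists_finite_frame {B : Type} [BooleanAlgebra B] (A : TS4Algebra B)
    {φ : Formula TS4Op} (h : ¬ A.Valid φ) :
    ∃ (X : Type) (_ : Finite X) (F : TS4Frame X), ¬ F.Valid φ := by
  obtain ⟨v, hv⟩ := not_forall.1 h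
  set S : Set B := subvalues A.ops v φ with hS
  have hSfin : S.Finite := finite_subvalues A.ops v φ
  obtain ⟨D, hDfin, hTD, hDU, hD, hDt, hDb, hDe⟩ := exists_finite_sublattice
    (U := {u | A.box u = u}) A.box_s4.isSublattice A.box_s4.map_top A.box_s4.map_bot
    (e := A.diaP) (fun a _ => A.box_eq_of_boxF_eq (A.boxF_diaP a))
    (fun a _ b _ => A.diaP_sup a b) (fun a _ => A.le_diaP a)
    (fun a _ b hb => A.diaP_diaP_inf a hb)
    -- Complements are included for the sake of `■_P`: not `■_P a` but its complement `◆_P ¬a` is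
    -- fixed by `■_F`, hence by `□`.
    (T := (S ∪ compl '' S) ∩ {u | A.box u = u})
    ((hSfin.union (hSfin.image _)).inter_of_left _) Set.inter_subset_right
  set G : Set B := D ∩ {b | A.boxF b = b} with hGdef
  have hG : IsSublattice G := hD.inter A.boxF_s4.isSublattice
  have hGt : ⊤ ∈ G := ⟨hDt, A.boxF_s4.map_top⟩
  have hGb : ⊥ ∈ G := ⟨hDb, A.boxF_s4.map_bot⟩
  have hdiaG : ∀ u ∈ D, A.diaP u ∈ G := fun u hu => ⟨hDe u hu, A.boxF_diaP u⟩
  -- The law for `◆_P` confines `D` to `□`-fixed elements, so `S` has to be added for the traces to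
  -- determine the subformula values.
  set F : Set B := S ∪ D with hF
  have hDF : D ⊆ F := Set.subset_union_right
  have hSF : S ⊆ F := Set.subset_union_left
  let M : TS4Frame (Trace F) :=
    { R := fun s t => ∀ u ∈ D, s.rep u → t.rep u
      Q := fun s t => ∀ u ∈ G, s.rep u → t.rep u
      R_refl := fun _ _ _ => id
      R_trans := fun _ _ _ h1 h2 u hu h => h2 u hu (h1 u hu h)
      Q_refl := fun _ _ _ => id
      Q_trans := fun _ _ _ h1 h2 u hu h => h2 u hu (h1 u hu h)
      R_sub_Q := fun _ _ h u hu => h u hu.1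
      exists_of_Q := by
        intro s t hst
        obtain ⟨x, h1, h2⟩ := Point.exists_amalgam hD.2 hDt hG hGt hGb (e := A.diaP)
          (fun u hu b hb c hc => A.diaP_inf_le (hDU hu) hb.2 hc.2) s.rep t.rep
          fun u hu hsu => hst _ (hdiaG u hu) (s.rep.mono (A.le_diaP u) hsu)
        exact ⟨Trace.mk F x, fun u hu hsu => (Trace.rep_mk x (hDF hu)).2 (h1 u hu hsu),
          fun u hu h => (h2 u hu).1 ((Trace.rep_mk x (hDF hu.1)).1 h),
          fun u hu h => (Trace.rep_mk x (hDF hu.1)).2 ((h2 u hu).2 h)⟩ }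
  obtain ⟨w, t, ht⟩ := Formula.exists_not_sat (f := A.ops) (rel := M.rel) hSF (by
    rintro (_ | _ | _) a ha hia t
    · exact A.box_s4.rep_iff hDF hD hDt hDU (hSF ha)
        (hTD ⟨.inl hia, A.box_s4.idem a⟩) t
    · exact A.boxF_s4.rep_iff (Set.inter_subset_left.trans hDF) hG hGt (fun u hu => hu.2)
        (hSF ha) ⟨hTD ⟨.inl hia, A.box_eq_of_boxF_eq (A.boxF_s4.idem a)⟩, A.boxF_s4.idem a⟩ t
    · have heq : (A.boxP a)ᶜ = A.diaP aᶜ := by rw [diaP, compl_compl]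
      have hG' : (A.boxP a)ᶜ ∈ G := by
        have hfix : A.boxF (A.boxP a)ᶜ = (A.boxP a)ᶜ := heq ▸ A.boxF_diaP aᶜ
        exact ⟨hTD ⟨.inr ⟨_, hia, rfl⟩, A.box_eq_of_boxF_eq hfix⟩, hfix⟩
      refine ⟨fun (h : t.rep (A.boxP a)) s hs => by_contra fun hsa => ?_,
        fun h => by_contra fun (hn : ¬ t.rep (A.boxP a)) => ?_⟩
      · exact (t.rep.compl_iff _).1 (hs _ hG' ((s.rep.compl_iff _).2
          fun h1 => hsa (s.rep.mono (A.boxP_s4.le_self a) h1))) h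
      -- A `Q`-predecessor of `t` refuting `a`: its `G`-part must lie inside that of `t`, and `¬a ≤
      -- c ∈ G` would give `◆_P ¬a ≤ c`.
      obtain ⟨x, h1, h2⟩ := Point.exists_of_forall_not_le
        (P := {aᶜ}) (N := {c | c ∈ G ∧ ¬ t.rep c}) infClosed_singleton
        (Set.singleton_nonempty _)
        (by
          rintro c ⟨hc, htc⟩ d ⟨hd, htd⟩
          exact ⟨hG.1 hc hd, by simp [htc, htd]⟩)
        ⟨⊥, hGb, t.rep.not_bot⟩
        (by
          rintro _ rfl c ⟨hc, htc⟩ hle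
          exact htc (t.rep.mono (A.diaP_le hc.2 hle)
            (heq ▸ (t.rep.compl_iff _).2 hn)))
      refine (x.compl_iff a).1 (h1 _ rfl) ((Trace.rep_mk x (hSF ha)).1
        (h (Trace.mk F x) fun u hu hxu => by_contra fun htu => ?_))
      exact h2 u ⟨hu, htu⟩ ((Trace.rep_mk x (hDF hu.1)).1 hxu)) hv
  exact ⟨Trace F, Trace.finite (hSfin.union hDfin), M, fun h => ht (h w t)⟩

end TS4Algebra

/-! ### Lindenbaum algebras of the three logics -/

lemma MS4Axiom.s4 (i : MS4Op) (φ : Formula MS4Op) (h : S4Axiom i φ) :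
    ClassicalProvable MS4Axiom φ := by
  cases i with
  | box => exact .ax (.box h)
  | all => exact .ax (.all (.s4 h))

/-- The Lindenbaum algebra of `MS4`. -/
def MS4Algebra.lindenbaum : MS4Algebra (ClassicalLindenbaum MS4Axiom.s4) where
  box := ClassicalLindenbaum.ops MS4Axiom.s4 .box
  all := ClassicalLindenbaum.ops MS4Axiom.s4 .all
  box_s4 := ClassicalLindenbaum.isInterior_ops MS4Axiom.s4 .box
  all_s4 := ClassicalLindenbaum.isInterior_ops MS4Axiom.s4 .all
  all_s5 := by rintro ⟨φ⟩; exact ClassicalProvable.ax (.all (.b φ))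
  comm := by rintro ⟨φ⟩; exact ClassicalProvable.ax (.comm φ)

lemma MS4Algebra.ops_lindenbaum :
    MS4Algebra.lindenbaum.ops = ClassicalLindenbaum.ops MS4Axiom.s4 := by
  funext i
  cases i <;> rfl

lemma MS4Algebra.not_valid_lindenbaum {φ : Formula MS4Op} (h : ¬ MS4Provable φ) :
    ¬ MS4Algebra.lindenbaum.Valid φ := by
  obtain ⟨v, hv⟩ := ClassicalProvable.exists_eval_ne_top MS4Axiom.s4 h
  exact fun h1 => hv (MS4Algebra.ops_lindenbaum ▸ h1 v)

lemma TS4Axiom.s4 (i : TS4Op) (φ : Formula TS4Op) (h : S4Axiom i φ) :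
    ClassicalProvable TS4Axiom φ := by
  cases i with
  | box => exact .ax (.box h)
  | boxF => exact .ax (.boxF h)
  | boxP => exact .ax (.boxP h)

/-- The Lindenbaum algebra of `TS4`. -/
def TS4Algebra.lindenbaum : TS4Algebra (ClassicalLindenbaum TS4Axiom.s4) where
  box := ClassicalLindenbaum.ops TS4Axiom.s4 .box
  boxF := ClassicalLindenbaum.ops TS4Axiom.s4 .boxF
  boxP := ClassicalLindenbaum.ops TS4Axiom.s4 .boxP
  box_s4 := ClassicalLindenbaum.isInterior_ops TS4Axiom.s4 .box
  boxF_s4 := ClassicalLindenbaum.isInterior_ops TS4Axiom.s4 .boxF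
  boxP_s4 := ClassicalLindenbaum.isInterior_ops TS4Axiom.s4 .boxP
  pf := by rintro ⟨φ⟩; exact ClassicalProvable.ax (.pf φ)
  fp := by rintro ⟨φ⟩; exact ClassicalProvable.ax (.fp φ)
  t1 := by rintro ⟨φ⟩; exact ClassicalProvable.ax (.t1 φ)
  t2 := by rintro ⟨φ⟩; exact ClassicalProvable.ax (.t2 φ)

lemma TS4Algebra.ops_lindenbaum :
    TS4Algebra.lindenbaum.ops = ClassicalLindenbaum.ops TS4Axiom.s4 := by
  funext i
  cases i <;> rfl

lemma TS4Algebra.not_valid_lindenbaum {φ : Formula TS4Op} (h : ¬ TS4Provable φ) :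
    ¬ TS4Algebra.lindenbaum.Valid φ := by
  obtain ⟨v, hv⟩ := ClassicalProvable.exists_eval_ne_top TS4Axiom.s4 h
  exact fun h1 => hv (TS4Algebra.ops_lindenbaum ▸ h1 v)

lemma MIPCProvable.isCongruential : IsCongruential MIPCProvable where
  ipc := .ipc
  mp := .mp
  congr i _ _ h _ := .reg i h

lemma MIPCProvable.of_iff {φ ψ : Formula MIPCOp} (h : MIPCProvable (iff φ ψ)) :
    MIPCProvable (imp φ ψ) ∧ MIPCProvable (imp ψ φ) :=
  ⟨.mp (.ipc (.and_left _ _)) h, .mp (.ipc (.and_right _ _)) h⟩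

/-- The Lindenbaum algebra of `MIPC`. -/
def MonadicHeytingAlgebra.lindenbaum :
    MonadicHeytingAlgebra (Lindenbaum MIPCProvable.isCongruential) where
  all := Lindenbaum.ops _ .all
  ex := Lindenbaum.ops _ .ex
  all_interior :=
    { map_inf := by
        rintro ⟨φ⟩ ⟨ψ⟩
        exact Quotient.sound (MIPCProvable.ax (.all_and φ ψ)).of_iff
      map_top := Lindenbaum.mk_eq_top_iff.2 (.nec (MIPCProvable.isCongruential.refl bot))
      le_self := by rintro ⟨φ⟩; exact MIPCProvable.ax (.all_le φ)
      le_idem := by rintro ⟨φ⟩; exact MIPCProvable.ax (.all_all φ) }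
  ex_closure :=
    { map_sup := by
        rintro ⟨φ⟩ ⟨ψ⟩
        exact Quotient.sound (MIPCProvable.ax (.ex_or φ ψ)).of_iff
      map_bot := by
        have h := MIPCProvable.isCongruential
        refine Quotient.sound ⟨?_, .ipc (.exfalso _)⟩
        -- The chain is `∃⊥ ≤ ∃∀⊥ ≤ ∀⊥ ≤ ⊥`.
        exact h.trans (h.trans (.reg .ex (.ipc (.exfalso _)))
          (MIPCProvable.ax (.ex_all bot)).of_iff.1) (.ax (.all_le bot))
      self_le := by rintro ⟨φ⟩; exact MIPCProvable.ax (.le_ex φ)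
      idem_le := by rintro ⟨φ⟩; exact MIPCProvable.ax (.ex_ex φ) }
  ex_inf := by
    have h := MIPCProvable.isCongruential
    rintro ⟨φ⟩ ⟨ψ⟩
    refine Quotient.sound ⟨h.and_intro ?_ (.reg .ex (.ipc (.and_right _ _))), .ax (.ex_and φ ψ)⟩
    exact h.trans (.reg .ex (.ipc (.and_left _ _))) (.ax (.ex_ex φ))
  all_ex := by
    rintro ⟨φ⟩
    exact Quotient.sound (MIPCProvable.ax (.all_ex φ)).of_iff.symm
  ex_all := by
    rintro ⟨φ⟩
    exact Quotient.sound (MIPCProvable.ax (.ex_all φ)).of_iff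

lemma MonadicHeytingAlgebra.not_valid_lindenbaum {φ : Formula MIPCOp}
    (h : ¬ MIPCProvable φ) : ¬ MonadicHeytingAlgebra.lindenbaum.Valid φ := by
  refine fun h1 => h ((Lindenbaum.mk_eq_top_iff (h := MIPCProvable.isCongruential)).1
    ((Lindenbaum.eval_mk φ).symm.trans ?_))
  convert h1 fun n => Lindenbaum.mk _ (letter n) using 2
  funext i
  cases i <;> rfl

/-! ### The finite model property -/

theorem TS4_hasFMP : TS4HasFMP := by
  intro φ
  have h1 : ¬ TS4Provable φ → ∃ (X : Type) (_ : Finite X) (F : TS4Frame X), ¬ F.Valid φ :=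
    fun h => TS4Algebra.lindenbaum.exists_finite_frame (TS4Algebra.not_valid_lindenbaum h)
  refine ⟨⟨fun h => ?_, ?_⟩, h1, ?_⟩
  · obtain ⟨X, _, F, hF⟩ := h1 h
    exact ⟨Set X, inferInstance, inferInstance, _, F.not_valid_complexAlgebra hF⟩
  · rintro ⟨B, _, _, A, hA⟩ h
    exact hA (A.valid_of_provable h)
  · rintro ⟨X, _, F, hF⟩ h
    exact F.not_valid_complexAlgebra hF (F.complexAlgebra.valid_of_provable h)

theorem MS4_hasFMP : MS4HasFMP := by
  intro φ
  have h1 : ¬ MS4Provable φ → ∃ (X : Type) (_ : Finite X) (F : MS4Frame X), ¬ F.Valid φ :=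
    fun h => MS4Algebra.lindenbaum.exists_finite_frame (MS4Algebra.not_valid_lindenbaum h)
  refine ⟨⟨fun h => ?_, ?_⟩, h1, ?_⟩
  · obtain ⟨X, _, F, hF⟩ := h1 h
    exact ⟨Set X, inferInstance, inferInstance, _, F.not_valid_complexAlgebra hF⟩
  · rintro ⟨B, _, _, A, hA⟩ h
    exact hA (A.valid_of_provable h)
  · rintro ⟨X, _, F, hF⟩ h
    exact F.not_valid_complexAlgebra hF (F.complexAlgebra.valid_of_provable h)

theorem MIPC_hasFMP : MIPCHasFMP := by
  intro φ
  have h1 : ¬ MIPCProvable φ → ∃ (X : Type) (_ : Finite X) (F : MIPCFrame X), ¬ F.Valid φ :=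
    fun h => MonadicHeytingAlgebra.lindenbaum.exists_finite_frame
      (MonadicHeytingAlgebra.not_valid_lindenbaum h)
  refine ⟨⟨fun h => ?_, ?_⟩, h1, ?_⟩
  · obtain ⟨X, _, F, hF⟩ := h1 h
    have : Finite F.Carrier := ‹Finite X›
    exact ⟨F.Upset, inferInstance, Finite.of_injective _ SetLike.coe_injective, _,
      F.not_valid_complexAlgebra hF⟩
  · rintro ⟨B, _, _, A, hA⟩ h
    exact hA (A.valid_of_provable h)
  · rintro ⟨X, _, F, hF⟩ h
    exact F.not_valid_complexAlgebra hF (F.complexAlgebra.valid_of_provable h)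

end MonadicLogic

theorem mainTheorem7 :
    MonadicLogic.TS4HasFMP ∧ MonadicLogic.MS4HasFMP ∧ MonadicLogic.MIPCHasFMP :=
  ⟨MonadicLogic.TS4_hasFMP, MonadicLogic.MS4_hasFMP, MonadicLogic.MIPC_hasFMP⟩
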